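/- Let $n\ge 0$ and let $\Omega_n^{epi}$ be the category of pruned trees with $n$ levels. Its objects are the sequences $\underline\tau=\{\underline t_0\xrightarrow{\tau_1}\underline t_1\to\cdots\xrightarrow{\tau_n}\underline t_n=*\}$ of nondecreasing surjections between ordinals $\underline r=\{1<\dots<r\}$; the elements of $\underline t_i$ are called the vertices of level $i$, and $\tau_{i+1}(x)$ is the parent of $x\in\underline t_i$. A morphism $u:\underline\tau\to\underline\sigma$ is a sequence of surjections $u:\underline t_i\to\underline s_i$ commuting with the maps $\tau_i,\sigma_i$ and nondecreasing on each fiber $\tau_{i+1}^{-1}(x)$. Put $\deg\underline\tau=t_0+\dots+t_{n-1}$ and $\deg u=\deg\underline\tau-\deg\underline\sigma$. For a commutative ring $\Bbbk$, the $\Bbbk$-linear version of $\Omega_n^{epi}$ has the same objects, and its modules of morphisms are freely generated by the morphisms of $\Omega_n^{epi}$. Consider the quadratic identities $v_1w_1=v_2w_2$ in $\Omega_n^{epi}$, where $v_1,w_1,v_2,w_2$ are morphisms of degree $1$ and $w_1,w_2$ have the same source $\underline\tau$, of the following three types. 1. (Consecutive merging) For three consecutive vertices $a,b=a+1,c=a+2$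 of some level of $\underline\tau$ with the same parent, $w_1$ merges $a$ with $b$ and then $v_1$ merges the result with (the image of) $c$, while $w_2$ merges $b$ with $c$ and then $v_2$ merges $a$ with the result. 2. (Disjoint merging) For two disjoint pairs $(a,b=a+1)$ and $(c,d=c+1)$ of consecutive vertices of $\underline\tau$, the two vertices of each pair having the same parent (the two pairs may lie on different levels or over different parents), $w_1$ merges $a$ with $b$ and then $v_1$ merges $c$ with $d$, while $w_2$ merges $c$ with $d$ and then $v_2$ merges $a$ with $b$. 3. (Nested merging) For two consecutive vertices $a,b=a+1$ of $\underline\tau$ with the same parent, a child $c$ of $a$ and a child $d$ of $b$, both $w_1$ and $w_2$ merge $a$ with $b$; $w_1$ places $c$ immediately before $d$ and $w_2$ places $d$ immediately before $c$; then $v_1$ and $v_2$ merge $c$ with $d$. Then every morphism $u$ of degree $2$ has exactly two factorizations $u=v_1w_1=v_2w_2$ into morphisms of degree $1$, and they form an identity of one of these three types. The category $\Omega_n^{epi}$ is generated by its morphisms of degree $1$, and all relations between them are generated by the quadratic identities of types 1, 2, 3. Explicitly: (a) (set-theoretic version) the canonical functor from the quotient of the free category on the quiver of degree-$1$ morphisms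 by the congruence generated by these identities to $\Omega_n^{epi}$ is an isomorphism of categories; (b) ($\Bbbk$-linear version) for every commutative ring $\Bbbk$, the canonical functor from the free $\Bbbk$-linear category on this quiver to the $\Bbbk$-linear version of $\Omega_n^{epi}$ is bijective on objects and surjective on morphisms, and its kernel is the two-sided ideal generated by the differences of the two sides of these identities. -/

import Mathlib

open CategoryTheory

/-- A pruned planar level tree with levels `0, …, n`: a sequence of nondecreasing surjections
`t₀ → t₁ → ⋯ → tₙ = *` of finite ordinals, where `Fin r` stands for `{1 < ⋯ < r}`.
`size i` is the number of vertices of level `i`, and `parent i` is the surjection from level `i`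
to level `i + 1`. The sequence is indexed by all natural numbers and continued, in the only
possible way, by one-point sets above level `n`. -/
structure PrunedTree (n : ℕ) where
  size : ℕ → ℕ
  size_eq_one : ∀ i, n ≤ i → size i = 1
  parent : ∀ i, Fin (size i) → Fin (size (i + 1))
  parent_mono : ∀ i, Monotone (parent i)
  parent_surj : ∀ i, Function.Surjective (parent i)

namespace PrunedTree

variable {n : ℕ}

/-- A morphism of pruned trees: levelwise surjections that commute with the parent maps
and are nondecreasing on each set of vertices with a common parent. -/
@[ext]
structure Hom (τ σ : PrunedTree n) where
  app : ∀ i, Fin (τ.size i) → Fin (σ.size i)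
  app_surj : ∀ i, Function.Surjective (app i)
  comm : ∀ i x, app (i + 1) (τ.parent i x) = σ.parent i (app i x)
  mono : ∀ i x y, τ.parent i x = τ.parent i y → x ≤ y → app i x ≤ app i y

/-- The category `Ω_n^epi` of pruned trees with `n` levels (as an ordinary category). -/
instance : Category (PrunedTree n) where
  Hom := Hom
  id τ :=
    { app := fun _ x => x
      app_surj := fun _ x => ⟨x, rfl⟩
      comm := fun _ _ => rfl
      mono := fun _ _ _ _ h => h }
  comp {τ θ σ} w v :=
    { app := fun i x => v.app i (w.app i x)
      app_surj := fun i => (v.app_surj i).comp (w.app_surj i)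
      comm := fun i x => by rw [w.comm, v.comm]
      mono := fun i x y h hxy =>
        v.mono i _ _ (by rw [← w.comm, ← w.comm, h]) (w.mono i x y h hxy) }

/-- The degree of a tree: its number of vertices of level `< n`. -/
def degree (τ : PrunedTree n) : ℕ := ∑ i ∈ Finset.range n, τ.size i

/-- The degree of a morphism. -/
def Hom.degree {τ σ : PrunedTree n} (_ : Hom τ σ) : ℤ :=
  (τ.degree : ℤ) - (σ.degree : ℤ)

/-- `Fuses w k a b`: the vertices `a`, `b` of level `k` are consecutive (`b = a + 1`), have the
same parent, and are identified by `w`. -/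
def Fuses {τ σ : PrunedTree n} (w : τ ⟶ σ) (k : ℕ) (a b : Fin (τ.size k)) : Prop :=
  (b : ℕ) = (a : ℕ) + 1 ∧ τ.parent k a = τ.parent k b ∧ Hom.app w k a = Hom.app w k b

section Squares

variable {τ θ₁ θ₂ σ : PrunedTree n} (w₁ : τ ⟶ θ₁) (v₁ : θ₁ ⟶ σ) (w₂ : τ ⟶ θ₂) (v₂ : θ₂ ⟶ σ)

/-- Three consecutive vertices `a`, `b`, `c` with a common parent are merged: on one side
`a` is merged with `b`, then the result with `c`; on the other side `b` is merged with `c`,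
then `a` with the result. -/
def ConsecutiveMerging : Prop :=
  ∃ (k : ℕ) (a b c : Fin (τ.size k)),
    Fuses w₁ k a b ∧ Fuses v₁ k (Hom.app w₁ k b) (Hom.app w₁ k c) ∧
    Fuses w₂ k b c ∧ Fuses v₂ k (Hom.app w₂ k a) (Hom.app w₂ k b)

/-- Two disjoint pairs `(a, b)` and `(c, d)` of consecutive vertices, the vertices of each pair
having a common parent, are merged, in one order or in the other. The two pairs may lie on
different levels or over different parents. -/
def DisjointMerging : Prop :=
  ∃ (k l : ℕ) (a b : Fin (τ.size k)) (c d : Fin (τ.size l)),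
    (k = l → (b : ℕ) < (c : ℕ) ∨ (d : ℕ) < (a : ℕ)) ∧
    Fuses w₁ k a b ∧ Fuses v₁ l (Hom.app w₁ l c) (Hom.app w₁ l d) ∧
    Fuses w₂ l c d ∧ Fuses v₂ k (Hom.app w₂ k a) (Hom.app w₂ k b)

/-- Two consecutive vertices `a`, `b` with a common parent are merged, then a child `c` of `a`
is merged with a child `d` of `b`: on one side the first merging places `c` immediately
before `d`, on the other side it places `d` immediately before `c`. -/
def NestedMerging : Prop :=
  ∃ (k : ℕ) (a b : Fin (τ.size (k + 1))) (c d : Fin (τ.size k)),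
    τ.parent k c = a ∧ τ.parent k d = b ∧
    Fuses w₁ (k + 1) a b ∧ Fuses v₁ k (Hom.app w₁ k c) (Hom.app w₁ k d) ∧
    Fuses w₂ (k + 1) a b ∧ Fuses v₂ k (Hom.app w₂ k d) (Hom.app w₂ k c)

end Squares

/-- The vertices of the quiver of generators of `Ω_n^epi`: all pruned trees. -/
structure DegreeOne (n : ℕ) where
  tree : PrunedTree n

/-- The arrows of the quiver of generators of `Ω_n^epi`: the morphisms of degree `1`. -/
instance : Quiver (DegreeOne n) where
  Hom X Y := {u : X.tree ⟶ Y.tree // Hom.degree u = 1}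

/-- The functor from the free category on the morphisms of degree `1` to `Ω_n^epi` that sends a
formal composite to the actual composite. -/
def composite (n : ℕ) : Paths (DegreeOne n) ⥤ PrunedTree n :=
  Paths.lift
    { obj := fun X => X.tree
      map := fun u => u.1 }

/-- The quadratic identities `v₁ w₁ = v₂ w₂` between formal composites of morphisms of
degree `1`: those given by commutative squares of one of the three types. -/
inductive QuadraticRelation (n : ℕ) : HomRel (Paths (DegreeOne n))
  | intro {τ θ₁ θ₂ σ : DegreeOne n} (w₁ : τ ⟶ θ₁) (v₁ : θ₁ ⟶ σ) (w₂ : τ ⟶ θ₂) (v₂ : θ₂ ⟶ σ)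
      (comm : w₁.1 ≫ v₁.1 = w₂.1 ≫ v₂.1)
      (type : ConsecutiveMerging w₁.1 v₁.1 w₂.1 v₂.1 ∨ DisjointMerging w₁.1 v₁.1 w₂.1 v₂.1 ∨
        NestedMerging w₁.1 v₁.1 w₂.1 v₂.1) :
      QuadraticRelation n ((Paths.of _).map w₁ ≫ (Paths.of _).map v₁)
        ((Paths.of _).map w₂ ≫ (Paths.of _).map v₂)

theorem composite_map_of {X Y : DegreeOne n} (u : X ⟶ Y) :
    (composite n).map ((Paths.of (DegreeOne n)).map u) = u.1 :=
  Paths.lift_toPath _ u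

theorem QuadraticRelation.composite_eq (X Y : Paths (DegreeOne n)) (p q : X ⟶ Y)
    (h : QuadraticRelation n p q) : (composite n).map p = (composite n).map q := by
  cases h with
  | intro w₁ v₁ w₂ v₂ comm _ =>
    rw [Functor.map_comp, Functor.map_comp, composite_map_of, composite_map_of,
      composite_map_of, composite_map_of]
    exact comm

/-- The functor to `Ω_n^epi` from the category presented by the morphisms of degree `1`
and the quadratic relations. -/
def presentation (n : ℕ) : CategoryTheory.Quotient (QuadraticRelation n) ⥤ PrunedTree n :=
  CategoryTheory.Quotient.lift (QuadraticRelation n) (composite n) QuadraticRelation.composite_eq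

universe u

theorem mapDomain_comp_aux (k : Type u) [CommRing k] {C D : Type*} [Category* C] [Category* D]
    (F : C ⥤ D) {X Y Z : C} (f : (X ⟶ Y) →₀ k) (g : (Y ⟶ Z) →₀ k) :
    Finsupp.mapDomain (fun p : X ⟶ Z => F.map p)
        (f.sum fun p r => g.sum fun q s => Finsupp.single (p ≫ q) (r * s)) =
      (Finsupp.mapDomain (fun p : X ⟶ Y => F.map p) f).sum fun p r =>
        (Finsupp.mapDomain (fun p : Y ⟶ Z => F.map p) g).sum fun q s =>
          Finsupp.single (p ≫ q) (r * s) := by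
  rw [Finsupp.sum_mapDomain_index (by simp) (by simp [add_mul]), Finsupp.sum,
    Finsupp.mapDomain_finsetSum]
  refine Finset.sum_congr rfl fun p _ => ?_
  beta_reduce
  rw [Finsupp.sum_mapDomain_index (by simp) (by simp [mul_add]), Finsupp.sum,
    Finsupp.mapDomain_finsetSum]
  refine Finset.sum_congr rfl fun q _ => ?_
  beta_reduce
  rw [Finsupp.mapDomain_single, F.map_comp]

/-- The `k`-linear extension of a functor to the free `k`-linear categories. -/
noncomputable def freeMap (k : Type u) [CommRing k] {C D : Type*} [Category* C] [Category* D]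
    (F : C ⥤ D) : Free k C ⥤ Free k D where
  obj X := F.obj X
  map {X Y} f := Finsupp.mapDomain (fun p : @Quiver.Hom C _ X Y => F.map p) f
  map_id X := by
    refine Finsupp.mapDomain_single.trans ?_
    exact congrArg (fun t => Finsupp.single t (1 : k)) (F.map_id X)
  map_comp f g := mapDomain_comp_aux k F f g

/-- The `k`-linear extension of `composite n`, from the free `k`-linear category on the
morphisms of degree `1` to the `k`-linear category `Ω_n^epi`, whose modules of morphisms are
freely generated by the morphisms of pruned trees. -/
noncomputable def linearComposite (k : Type u) [CommRing k] (n : ℕ) :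
    Free k (Paths (DegreeOne n)) ⥤ Free k (PrunedTree n) :=
  freeMap k (composite n)

/-- The two-sided ideal of the free `k`-linear category on the morphisms of degree `1` that is
generated by the differences of the two sides of the quadratic relations. -/
noncomputable def quadraticIdeal (k : Type u) [CommRing k] (n : ℕ)
    (X Y : Free k (Paths (DegreeOne n))) : Submodule k (X ⟶ Y) :=
  Submodule.span k
    {x | ∃ (A B : Paths (DegreeOne n)) (p q : A ⟶ B)
      (f : X ⟶ (Free.embedding k _).obj A) (g : (Free.embedding k _).obj B ⟶ Y),
      QuadraticRelation n p q ∧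
        x = f ≫ ((Free.embedding k _).map p - (Free.embedding k _).map q) ≫ g}

end PrunedTree

/-! ### Degrees, and morphisms of degree zero and one -/

namespace PrunedTree

variable {n : ℕ}

/-! The degree of a morphism counts the vertices it loses. On the highest level where a morphism is
not injective, identified vertices have equal parents, so some consecutive siblings are fused
(`exists_fuses`). A morphism `u` fusing siblings `a`, `b` factors through a morphism of degree one
fusing only these: order each level lexicographically by parent, image under `u` and a tie-breaking
key that is equal only on `a` and `b`, and pass to the quotient (`exists_factorization_of_key`).
Hence degree one generates.

In degree two, let `w₁` fuse `a`, `b` and let `v₁` identify a further pair. If that pair comes from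
siblings of the source, these may be fused first instead, which gives types 1 and 2. Otherwise it
comes from a child of `a` and a child of `b`, and the two factorizations differ in the order of
these children, which gives type 3. No others exist, because first steps fusing the same siblings
agree unless they order some pair with the same final image differently (`exists_inversion`).

For the relations, any two factorizations of `u` with a first step of degree one (`Atom u`) are
joined by a chain of squares (`Atom.eqvGen_adj`). If they fuse the same siblings, a bubble sort of
the children removes inversions one at a time (`exists_adj_of_inversion`); otherwise one square
reduces to that case (`eqvGen_of_le`). Induction on the degree then identifies all paths with the
same composite (`pathClass_eq`). The linear version follows because the kernel of a map induced on
free modules by a map of bases is spanned by differences of basis elements with the same image. -/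

/-- Downward induction on the levels of a tree. -/
theorem level_induction (n : ℕ) {P : ℕ → Prop} (top : ∀ i, n ≤ i → P i)
    (step : ∀ i, P (i + 1) → P i) (i : ℕ) : P i := by
  have key : ∀ m i, n - i = m → P i := by
    intro m
    induction m with
    | zero => exact fun i hi => top i (by omega)
    | succ m ih => exact fun i hi => step i (ih (i + 1) (by omega))
  exact key _ i rfl

theorem eq_of_top (τ : PrunedTree n) {i : ℕ} (hi : n ≤ i) (x y : Fin (τ.size i)) : x = y := by
  have := τ.size_eq_one i hi
  exact Fin.ext (by omega)

section Basic

variable {τ θ σ : PrunedTree n}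

@[simp]
theorem comp_app (w : τ ⟶ θ) (v : θ ⟶ σ) (i : ℕ) (x : Fin (τ.size i)) :
    Hom.app (w ≫ v) i x = Hom.app v i (Hom.app w i x) := rfl

theorem hom_ext {u v : τ ⟶ σ} (h : ∀ i x, Hom.app u i x = Hom.app v i x) : u = v :=
  Hom.ext (funext fun i => funext fun x => h i x)

theorem eq_of_comp_eq (w : τ ⟶ θ) {v v' : θ ⟶ σ} (h : w ≫ v = w ≫ v') : v = v' := by
  refine hom_ext fun i z => ?_
  obtain ⟨x, rfl⟩ := w.app_surj i z
  rw [← comp_app, h, comp_app]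

theorem degree_comp (w : τ ⟶ θ) (v : θ ⟶ σ) :
    Hom.degree (w ≫ v) = Hom.degree w + Hom.degree v := by
  simp only [Hom.degree]
  ring

/-- The vertices of level `< n`. -/
abbrev Vertices (τ : PrunedTree n) : Type := Σ i : Fin n, Fin (τ.size i)

theorem card_vertices (τ : PrunedTree n) : Fintype.card τ.Vertices = τ.degree := by
  simp [degree, Finset.sum_range]

/-- The action of a morphism on all vertices of level `< n`. -/
def Hom.total (w : τ ⟶ σ) (x : τ.Vertices) : σ.Vertices := ⟨x.1, w.app _ x.2⟩

theorem Hom.total_surjective (w : τ ⟶ σ) : Function.Surjective (Hom.total w) := by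
  rintro ⟨i, z⟩
  obtain ⟨x, rfl⟩ := w.app_surj i z
  exact ⟨⟨i, x⟩, rfl⟩

theorem degree_nonneg (w : τ ⟶ σ) : 0 ≤ Hom.degree w := by
  have := Fintype.card_le_of_surjective _ (Hom.total_surjective w)
  rw [card_vertices, card_vertices] at this
  simp only [Hom.degree]
  omega

theorem level_lt {i : ℕ} {x y : Fin (τ.size i)} (h : x ≠ y) : i < n := by
  by_contra hi
  exact h (eq_of_top τ (by omega) x y)

theorem injective_of_total {w : τ ⟶ σ} (h : Function.Injective (Hom.total w)) (i : ℕ) :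
    Function.Injective (Hom.app w i) := by
  intro x y hxy
  by_contra hne
  have hi := level_lt hne
  have : (⟨⟨i, hi⟩, x⟩ : τ.Vertices) = ⟨⟨i, hi⟩, y⟩ := h (by simp [Hom.total, hxy])
  simp at this
  exact hne this

theorem injective_of_degree_eq_zero {w : τ ⟶ σ} (h : Hom.degree w = 0) (i : ℕ) :
    Function.Injective (Hom.app w i) := by
  refine injective_of_total ?_ i
  have hc : Fintype.card τ.Vertices = Fintype.card σ.Vertices := by
    rw [card_vertices, card_vertices]
    simp only [Hom.degree] at h
    omega
  exact ((Fintype.bijective_iff_surjective_and_card _).2 ⟨Hom.total_surjective w, hc⟩).1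

theorem degree_eq_zero_of_injective {w : τ ⟶ σ} (h : ∀ i, Function.Injective (Hom.app w i)) :
    Hom.degree w = 0 := by
  have hb : ∀ i, τ.size i = σ.size i := fun i => by
    simpa using Fintype.card_of_bijective ⟨h i, w.app_surj i⟩
  simp [Hom.degree, degree, hb]

end Basic

/-- A surjection onto a set with one element less identifies exactly one pair. -/
theorem eq_or_eq_of_card_eq_succ {α β : Type*} [Fintype α] [Fintype β] {f : α → β}
    (hf : Function.Surjective f) (hc : Fintype.card α = Fintype.card β + 1) {a b x y : α}
    (hab : a ≠ b) (h : f a = f b) (hxy : x ≠ y) (h' : f x = f y) : x = a ∨ y = a := by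
  classical
  by_contra! hne
  -- Without `a` the map is still surjective, now between sets of equal size, hence injective; but
  -- it identifies `x` and `y`.
  have hs : Function.Surjective (fun z : {z // z ≠ a} => f z.1) := by
    intro w
    obtain ⟨z, rfl⟩ := hf w
    by_cases hz : z = a
    · exact ⟨⟨b, hab.symm⟩, by simp [hz, h]⟩
    · exact ⟨⟨z, hz⟩, rfl⟩
  have hcard : Fintype.card {z // z ≠ a} = Fintype.card β := by
    rw [Fintype.card_subtype_compl, Fintype.card_subtype_eq]
    omega
  have hi := ((Fintype.bijective_iff_surjective_and_card _).2 ⟨hs, hcard⟩).1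
  exact hxy (congrArg Subtype.val (@hi ⟨x, hne.1⟩ ⟨y, hne.2⟩ h'))

theorem card_eq_succ_of_surjective {α β : Type*} [Fintype α] [Fintype β] {f : α → β}
    (hf : Function.Surjective f) {a b : α} (hab : a ≠ b) (h : f a = f b)
    (hu : ∀ x y, f x = f y → x ≠ a → y ≠ a → x = y) :
    Fintype.card α = Fintype.card β + 1 := by
  classical
  have hb : Function.Bijective (fun z : {z // z ≠ a} => f z.1) := by
    refine ⟨fun x y hxy => Subtype.ext (hu _ _ hxy x.2 y.2), fun w => ?_⟩
    obtain ⟨z, rfl⟩ := hf w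
    by_cases hz : z = a
    · exact ⟨⟨b, hab.symm⟩, by simp [hz, h]⟩
    · exact ⟨⟨z, hz⟩, rfl⟩
  have hcard := Fintype.card_of_bijective hb
  rw [Fintype.card_subtype_compl, Fintype.card_subtype_eq] at hcard
  have : 0 < Fintype.card α := Fintype.card_pos_iff.2 ⟨a⟩
  omega

section DegreeOneMorphisms

variable {τ θ σ : PrunedTree n}

/-- A morphism of degree one identifies a single pair of vertices. -/
theorem eq_of_app_eq {w : τ ⟶ σ} (hw : Hom.degree w = 1) {k j : ℕ} {a b : Fin (τ.size k)}
    {x y : Fin (τ.size j)} (hab : a < b) (h : Hom.app w k a = Hom.app w k b) (hxy : x < y)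
    (h' : Hom.app w j x = Hom.app w j y) : j = k ∧ (x : ℕ) = a ∧ (y : ℕ) = b := by
  have hk := level_lt hab.ne
  have hj := level_lt hxy.ne
  have hc : Fintype.card τ.Vertices = Fintype.card σ.Vertices + 1 := by
    rw [card_vertices, card_vertices]
    simp only [Hom.degree] at hw
    omega
  let A : τ.Vertices := ⟨⟨k, hk⟩, a⟩
  let B : τ.Vertices := ⟨⟨k, hk⟩, b⟩
  let S : τ.Vertices := ⟨⟨j, hj⟩, x⟩
  let T : τ.Vertices := ⟨⟨j, hj⟩, y⟩
  have hAB : A ≠ B := fun e => hab.ne (by simpa [A, B] using e)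
  have hST : S ≠ T := fun e => hxy.ne (by simpa [S, T] using e)
  have eAB : Hom.total w A = Hom.total w B := by simp [A, B, Hom.total, h]
  have eST : Hom.total w S = Hom.total w T := by simp [S, T, Hom.total, h']
  -- Both orders of the pair are needed: one application puts `A`, the other `B`, among `S`, `T`.
  have h1 := eq_or_eq_of_card_eq_succ (Hom.total_surjective w) hc hAB eAB hST eST
  have h2 := eq_or_eq_of_card_eq_succ (Hom.total_surjective w) hc hAB.symm eAB.symm hST eST
  have hjk : j = k := by
    rcases h1 with h1 | h1 <;> simpa [S, T, A] using congrArg (fun z => (z.1 : ℕ)) h1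
  subst hjk
  simp only [S, T, A, B, Sigma.mk.injEq, heq_eq_eq, true_and] at h1 h2
  refine ⟨rfl, ?_⟩
  simp only [Fin.ext_iff, Fin.lt_def] at *
  omega

/-- A morphism that identifies a single pair of vertices has degree one. -/
theorem degree_eq_one {w : τ ⟶ σ} {k : ℕ} {a b : Fin (τ.size k)} (hab : a < b)
    (h : Hom.app w k a = Hom.app w k b)
    (hu : ∀ j (x y : Fin (τ.size j)), x < y → Hom.app w j x = Hom.app w j y →
      j = k ∧ (x : ℕ) = a ∧ (y : ℕ) = b) : Hom.degree w = 1 := by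
  have hk := level_lt hab.ne
  have hc := card_eq_succ_of_surjective (Hom.total_surjective w)
    (a := (⟨⟨k, hk⟩, a⟩ : τ.Vertices)) (b := ⟨⟨k, hk⟩, b⟩)
    (fun e => hab.ne (by simpa using e)) (by simp [Hom.total, h]) (by
      rintro ⟨⟨i, hi⟩, x⟩ ⟨⟨j, hj⟩, y⟩ e hx hy
      have hij : i = j := by simpa [Hom.total] using congrArg (fun z => (z.1 : ℕ)) e
      subst hij
      simp only [Hom.total, Sigma.mk.injEq, heq_eq_eq, true_and] at e ⊢
      rcases lt_trichotomy x y with hxy | hxy | hxy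
      · obtain ⟨rfl, h1, -⟩ := hu i x y hxy e
        exact absurd (by simp [Fin.ext h1]) hx
      · exact hxy
      · obtain ⟨rfl, h1, -⟩ := hu i y x hxy e.symm
        exact absurd (by simp [Fin.ext h1]) hy)
  rw [card_vertices, card_vertices] at hc
  simp only [Hom.degree]
  omega

/-- The fibres of the parent map are intervals. -/
theorem parent_eq_of_mem {i : ℕ} {x y z : Fin (τ.size i)} (h : τ.parent i x = τ.parent i y)
    (hxz : x ≤ z) (hzy : z ≤ y) : τ.parent i x = τ.parent i z :=
  le_antisymm (τ.parent_mono i hxz) (h ▸ τ.parent_mono i hzy)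

theorem Fuses.lt {w : τ ⟶ σ} {k : ℕ} {a b : Fin (τ.size k)} (h : Fuses w k a b) : a < b := by
  have := h.1
  exact Fin.lt_def.2 (by omega)

/-- The successor of `x` lies between `x` and `y` in the same fibre, so monotonicity on the fibre
squeezes its image. -/
theorem exists_fuses_of_siblings {w : τ ⟶ σ} {k : ℕ} {x y : Fin (τ.size k)} (hxy : x < y)
    (hp : τ.parent k x = τ.parent k y) (h : Hom.app w k x = Hom.app w k y) :
    ∃ b : Fin (τ.size k), Fuses w k x b := by
  have hxy' := Fin.lt_def.1 hxy
  have h1 : x ≤ (⟨x + 1, by omega⟩ : Fin (τ.size k)) := Fin.le_def.2 (by simp)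
  have h2 : (⟨x + 1, by omega⟩ : Fin (τ.size k)) ≤ y := Fin.le_def.2 (by simpa using hxy')
  have hp' := parent_eq_of_mem hp h1 h2
  refine ⟨_, rfl, hp', le_antisymm (w.mono k _ _ hp' h1) ?_⟩
  exact h ▸ w.mono k _ _ (hp' ▸ hp) h2

/-- A morphism that identifies no consecutive siblings is levelwise injective. -/
theorem exists_fuses {w : τ ⟶ σ} (hw : Hom.degree w ≠ 0) :
    ∃ (k : ℕ) (a b : Fin (τ.size k)), Fuses w k a b := by
  by_contra! hne
  refine hw (degree_eq_zero_of_injective (level_induction n ?_ ?_))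
  · exact fun i hi x y _ => eq_of_top τ hi x y
  · intro i ih
    have key : ∀ x y, x < y → Hom.app w i x = Hom.app w i y → False := fun x y hxy h => by
      -- Injectivity one level up turns identified vertices into siblings.
      have hp : τ.parent i x = τ.parent i y := ih (by rw [w.comm, w.comm, h])
      obtain ⟨b, hb⟩ := exists_fuses_of_siblings hxy hp h
      exact hne _ _ _ hb
    intro x y h
    rcases lt_trichotomy x y with hxy | hxy | hxy
    · exact (key x y hxy h).elim
    · exact hxy
    · exact (key y x hxy h.symm).elim

/-- Some consecutive siblings are fused by `exists_fuses`, and by `eq_of_app_eq` no other pair is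
identified. -/
theorem fuses_of_lt {w : τ ⟶ σ} (hw : Hom.degree w = 1) {k : ℕ} {x y : Fin (τ.size k)}
    (hxy : x < y) (h : Hom.app w k x = Hom.app w k y) : Fuses w k x y := by
  obtain ⟨j, a, b, hf⟩ := exists_fuses (w := w) (by omega)
  obtain ⟨rfl, hx, hy⟩ := eq_of_app_eq hw hf.lt hf.2.2 hxy h
  rwa [Fin.ext hx, Fin.ext hy]

theorem parent_eq_of_app_eq {w : τ ⟶ σ} (hw : Hom.degree w = 1) {k : ℕ}
    {x y : Fin (τ.size k)} (h : Hom.app w k x = Hom.app w k y) :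
    τ.parent k x = τ.parent k y := by
  rcases lt_trichotomy x y with hxy | hxy | hxy
  · exact (fuses_of_lt hw hxy h).2.1
  · rw [hxy]
  · exact (fuses_of_lt hw hxy h.symm).2.1.symm

/-- A morphism is nondecreasing on the levels above which it is injective. -/
theorem monotone_of_injective_above (w : τ ⟶ σ) (i : ℕ)
    (h : ∀ j, i < j → Function.Injective (Hom.app w j)) : Monotone (Hom.app w i) := by
  revert h
  refine level_induction n (P := fun i => (∀ j, i < j → Function.Injective (Hom.app w j)) →
    Monotone (Hom.app w i)) ?_ ?_ i
  · intro i hi _ x y _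
    rw [eq_of_top τ hi x y]
  · intro i ih h x y hxy
    have hm := ih (fun j hj => h j (by omega)) (τ.parent_mono i hxy)
    rcases hm.lt_or_eq with hlt | heq
    · by_contra hyx
      have := σ.parent_mono i (not_le.1 hyx).le
      rw [← w.comm, ← w.comm] at this
      exact absurd hlt (not_lt.2 this)
    · exact w.mono i x y (h (i + 1) (by omega) heq) hxy

/-- The only morphisms of degree zero are the identities. -/
theorem degree_zero_induction {P : ∀ σ : PrunedTree n, (τ ⟶ σ) → Prop} (hid : P τ (𝟙 τ))
    (u : τ ⟶ σ) (hu : Hom.degree u = 0) : P σ u := by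
  have hi := injective_of_degree_eq_zero hu
  have hm : ∀ i, StrictMono (Hom.app u i) := fun i =>
    (monotone_of_injective_above u i fun j _ => hi j).strictMono_of_injective (hi i)
  have hb : τ.size = σ.size := funext fun i => by
    simpa using Fintype.card_of_bijective ⟨hi i, u.app_surj i⟩
  -- With the trees taken apart, `subst` on the sizes avoids transport along equalities of trees.
  obtain ⟨ts, t1, tp, tm, tsu⟩ := τ
  obtain ⟨ss, s1, sp, sm, ssu⟩ := σ
  obtain ⟨app, app_surj, comm, mono⟩ := u
  dsimp only at hb hm app app_surj comm mono
  subst hb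
  have happ : app = fun _ x => x := funext fun i =>
    ((hm i).range_inj strictMono_id).1 (by
      rw [(app_surj i).range_eq, Set.range_id])
  subst happ
  have hp : tp = sp := funext fun i => funext fun x => comm i x
  subst hp
  exact hid

end DegreeOneMorphisms

end PrunedTree

/-! ### Factorizations constructed from orders on the levels -/

namespace PrunedTree

variable {n : ℕ}

/-- Every key function on a finite ordinal is equivalent to a surjection onto an ordinal. -/
theorem exists_surjective_rank {m : ℕ} {L : Type*} [LinearOrder L] (g : Fin m → L) :
    ∃ (r : ℕ) (f : Fin m → Fin r), Function.Surjective f ∧ ∀ x y, f x ≤ f y ↔ g x ≤ g y := by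
  classical
  let s := Finset.univ.image g
  let e := s.orderIsoOfFin rfl
  refine ⟨s.card, fun x => e.symm ⟨g x, by simp [s]⟩, fun z => ?_, fun x y => by simp⟩
  obtain ⟨x, -, hx⟩ := Finset.mem_image.1 (e z).2
  exact ⟨x, by simp [hx]⟩

theorem exists_rank {m : ℕ} {L : Type*} [LinearOrder L] (g : Fin m → L) :
    ∃ f : Fin m → ℕ, ∀ x y, f x ≤ f y ↔ g x ≤ g y := by
  obtain ⟨r, f, -, hf⟩ := exists_surjective_rank g
  exact ⟨fun x => f x, hf⟩

/-- A compatible family of keys on the levels of a tree comes from a morphism. -/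
theorem exists_hom_of_keys (τ : PrunedTree n) (g : ∀ i, Fin (τ.size i) → ℕ)
    (hp : ∀ i x y, g i x ≤ g i y → g (i + 1) (τ.parent i x) ≤ g (i + 1) (τ.parent i y))
    (hs : ∀ i x y, τ.parent i x = τ.parent i y → x ≤ y → g i x ≤ g i y) :
    ∃ (θ : PrunedTree n) (w : τ ⟶ θ), ∀ i x y, Hom.app w i x ≤ Hom.app w i y ↔ g i x ≤ g i y := by
  choose r f hf hle using fun i => exists_surjective_rank (g i)
  -- The parent map of the quotient does not depend on the chosen preimage.
  have hc : ∀ i x, f (i + 1) (τ.parent i (Function.surjInv (hf i) (f i x))) =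
      f (i + 1) (τ.parent i x) := fun i x => by
    have h := Function.surjInv_eq (hf i) (f i x)
    exact le_antisymm ((hle _ _ _).2 (hp _ _ _ ((hle _ _ _).1 h.le)))
      ((hle _ _ _).2 (hp _ _ _ ((hle _ _ _).1 h.ge)))
  let θ : PrunedTree n :=
    { size := r
      size_eq_one := fun i hi => by
        have h1 := Fintype.card_le_of_surjective _ (hf i)
        have h2 := (f i ⟨0, by rw [τ.size_eq_one i hi]; exact one_pos⟩).pos
        simp only [Fintype.card_fin, τ.size_eq_one i hi] at h1
        omega
      parent := fun i z => f (i + 1) (τ.parent i (Function.surjInv (hf i) z))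
      parent_mono := fun i y z hyz => by
        refine (hle _ _ _).2 (hp _ _ _ ((hle _ _ _).1 ?_))
        rwa [Function.surjInv_eq (hf i), Function.surjInv_eq (hf i)]
      parent_surj := fun i z => by
        obtain ⟨x, rfl⟩ := hf _ z
        obtain ⟨x, rfl⟩ := τ.parent_surj i x
        exact ⟨f i x, hc i x⟩ }
  exact ⟨θ, ⟨f, hf, fun i x => (hc i x).symm, fun i x y h hxy => (hle _ _ _).2 (hs i x y h hxy)⟩,
    hle⟩

section

variable {τ θ θ' σ : PrunedTree n}

/-- The criterion for factoring a morphism `u` through a morphism `w`. -/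
theorem exists_comp_eq (w : τ ⟶ θ) (u : τ ⟶ σ)
    (h : ∀ i x y, Hom.app w (i + 1) (τ.parent i x) = Hom.app w (i + 1) (τ.parent i y) →
      Hom.app w i x ≤ Hom.app w i y → Hom.app u i x ≤ Hom.app u i y) :
    ∃ v : θ ⟶ σ, w ≫ v = u := by
  have hc : ∀ i x, Hom.app u i (Function.surjInv (w.app_surj i) (Hom.app w i x)) =
      Hom.app u i x := fun i x => by
    have e := Function.surjInv_eq (w.app_surj i) (Hom.app w i x)
    refine le_antisymm (h _ _ _ ?_ e.le) (h _ _ _ ?_ e.ge)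
    · rw [w.comm, w.comm, e]
    · rw [w.comm, w.comm, e]
  refine ⟨⟨fun i z => Hom.app u i (Function.surjInv (w.app_surj i) z), ?_, ?_, ?_⟩,
    hom_ext hc⟩
  · intro i z
    obtain ⟨x, rfl⟩ := u.app_surj i z
    exact ⟨Hom.app w i x, hc i x⟩
  · intro i z
    obtain ⟨x, rfl⟩ := w.app_surj i z
    rw [← w.comm, hc, hc, u.comm]
  · intro i y z hyz hle
    obtain ⟨x, rfl⟩ := w.app_surj i y
    obtain ⟨x', rfl⟩ := w.app_surj i z
    rw [hc, hc]
    refine h i x x' ?_ hle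
    rwa [w.comm, w.comm]

/-- The rank of a vertex for the lexicographic order given by the parent, the image under `u`
and the key `t`. -/
noncomputable def lexKey (u : τ ⟶ σ) (t : ∀ i, Fin (τ.size i) → ℕ) (i : ℕ) :
    Fin (τ.size i) → ℕ :=
  if n ≤ i then fun _ => 0 else
    (exists_rank fun x => toLex (lexKey u t (i + 1) (τ.parent i x),
      toLex ((Hom.app u i x : ℕ), t i x))).choose
termination_by n - i

/-- This eliminates the chosen ranks. It also covers the levels from `n` on, where both sides hold
since there is only one vertex. -/
theorem lexKey_le_iff (u : τ ⟶ σ) (t : ∀ i, Fin (τ.size i) → ℕ) (i : ℕ) (x y : Fin (τ.size i)) :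
    lexKey u t i x ≤ lexKey u t i y ↔
      lexKey u t (i + 1) (τ.parent i x) < lexKey u t (i + 1) (τ.parent i y) ∨
      lexKey u t (i + 1) (τ.parent i x) = lexKey u t (i + 1) (τ.parent i y) ∧
        (Hom.app u i x < Hom.app u i y ∨ Hom.app u i x = Hom.app u i y ∧ t i x ≤ t i y) := by
  by_cases hi : n ≤ i
  · simp [eq_of_top τ hi x y]
  · rw [lexKey, if_neg hi, (exists_rank _).choose_spec, Prod.Lex.toLex_le_toLex,
      Prod.Lex.toLex_le_toLex]
    simp [Fin.ext_iff]

/-- A morphism that identifies consecutive siblings factors through a morphism of degree one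
that identifies just these siblings; the order of the children that are identified by the morphism
may be prescribed. -/
theorem exists_factorization_of_key (u : τ ⟶ σ) {k : ℕ} {a b : Fin (τ.size k)}
    (hf : Fuses u k a b) (t : ∀ i, Fin (τ.size i) → ℕ)
    (hs : ∀ i x y, τ.parent i x = τ.parent i y → x < y → Hom.app u i x = Hom.app u i y →
      t i x ≤ t i y)
    (hab : t k a = t k b)
    (ht : ∀ i x y, x < y → t i x = t i y → i = k ∧ (x : ℕ) = a ∧ (y : ℕ) = b) :
    ∃ (θ : PrunedTree n) (w : τ ⟶ θ) (v : θ ⟶ σ), w ≫ v = u ∧ Hom.degree w = 1 ∧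
      Fuses w k a b ∧
      ∀ i x y, Hom.app w (i + 1) (τ.parent i x) = Hom.app w (i + 1) (τ.parent i y) →
        Hom.app u i x = Hom.app u i y → (Hom.app w i x ≤ Hom.app w i y ↔ t i x ≤ t i y) := by
  obtain ⟨θ, w, hw⟩ := exists_hom_of_keys τ (lexKey u t) (fun i x y h => by
    rcases (lexKey_le_iff _ _ _ _ _).1 h with h | h
    · exact h.le
    · exact h.1.le) (fun i x y h hxy => by
    rw [lexKey_le_iff, h]
    refine Or.inr ⟨rfl, (u.mono i x y h hxy).lt_or_eq.imp_right fun e => ⟨e, ?_⟩⟩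
    rcases hxy.lt_or_eq with hlt | rfl
    · exact hs i x y h hlt e
    · exact le_rfl)
  have heq : ∀ i x y, Hom.app w i x = Hom.app w i y ↔ lexKey u t i x = lexKey u t i y :=
    fun i x y => by rw [le_antisymm_iff, hw, hw, ← le_antisymm_iff]
  -- Once `w` identifies the parents, only `u` and then `t` decide the order.
  have hle : ∀ i x y, Hom.app w (i + 1) (τ.parent i x) = Hom.app w (i + 1) (τ.parent i y) →
      (Hom.app w i x ≤ Hom.app w i y ↔
        (Hom.app u i x < Hom.app u i y ∨ Hom.app u i x = Hom.app u i y ∧ t i x ≤ t i y)) :=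
    fun i x y h => by
      rw [hw, lexKey_le_iff, (heq _ _ _).1 h]
      simp
  obtain ⟨v, hv⟩ := exists_comp_eq w u fun i x y h hxy => by
    rcases (hle i x y h).1 hxy with h | h
    · exact h.le
    · exact h.1.le
  have hwab : Hom.app w k a = Hom.app w k b := by
    have hp := congrArg (Hom.app w (k + 1)) hf.2.1
    exact le_antisymm ((hle _ _ _ hp).2 (Or.inr ⟨hf.2.2, hab.le⟩))
      ((hle _ _ _ hp.symm).2 (Or.inr ⟨hf.2.2.symm, hab.ge⟩))
  refine ⟨θ, w, v, hv, degree_eq_one hf.lt hwab ?_, ⟨hf.1, hf.2.1, hwab⟩, ?_⟩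
  · intro i x y hxy h
    have hp : Hom.app w (i + 1) (τ.parent i x) = Hom.app w (i + 1) (τ.parent i y) := by
      rw [w.comm, w.comm, h]
    have h1 := (hle i x y hp).1 h.le
    have h2 := (hle i y x hp.symm).1 h.ge
    refine ht i x y hxy ?_
    rcases h1 with h1 | h1 <;> rcases h2 with h2 | h2
    · exact absurd h1 h2.not_gt
    · exact absurd h1 h2.1.le.not_gt
    · exact absurd h2 h1.1.le.not_gt
    · exact le_antisymm h1.2 h2.2
  · intro i x y hp hu
    rw [hle i x y hp]
    simp [hu]

/-- The key that identifies the vertex of position `a` of level `k` with its successor. -/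
def mergeKey (τ : PrunedTree n) (k a i : ℕ) (x : Fin (τ.size i)) : ℕ :=
  if i = k ∧ a < (x : ℕ) then (x : ℕ) - 1 else (x : ℕ)

/-- A morphism that identifies consecutive siblings factors through a morphism of degree one
that identifies just these siblings. -/
theorem exists_factorization (u : τ ⟶ σ) {k : ℕ} {a b : Fin (τ.size k)} (hf : Fuses u k a b) :
    ∃ (θ : PrunedTree n) (w : τ ⟶ θ) (v : θ ⟶ σ), w ≫ v = u ∧ Hom.degree w = 1 ∧
      Fuses w k a b := by
  have hab := hf.1
  obtain ⟨θ, w, v, h1, h2, h3, -⟩ := exists_factorization_of_key u hf (mergeKey τ k a)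
    (fun i x y _ hxy _ => by
      rw [Fin.lt_def] at hxy
      simp only [mergeKey]
      split_ifs <;> omega)
    (by simp [mergeKey, hab])
    (fun i x y hxy h => by
      rw [Fin.lt_def] at hxy
      simp only [mergeKey] at h
      split_ifs at h <;> omega)
  exact ⟨θ, w, v, h1, h2, h3⟩

/-- A morphism that identifies consecutive siblings `a`, `b` and no further siblings on the level
below factors through a morphism of degree one that identifies `a` and `b` and places a given
vertex `d` below the other vertices with the same image. -/
theorem exists_factorization_placing (u : τ ⟶ σ) {l : ℕ} {a b : Fin (τ.size (l + 1))}
    (hf : Fuses u (l + 1) a b) (d : Fin (τ.size l))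
    (hs : ∀ x y, τ.parent l x = τ.parent l y → Hom.app u l x = Hom.app u l y → x = y) :
    ∃ (θ : PrunedTree n) (w : τ ⟶ θ) (v : θ ⟶ σ), w ≫ v = u ∧ Hom.degree w = 1 ∧
      Fuses w (l + 1) a b ∧ ∀ c, c ≠ d →
        Hom.app w (l + 1) (τ.parent l c) = Hom.app w (l + 1) (τ.parent l d) →
        Hom.app u l c = Hom.app u l d → Hom.app w l d < Hom.app w l c := by
  have hab := hf.1
  obtain ⟨θ, w, v, h1, h2, h3, h4⟩ := exists_factorization_of_key u hf
    -- On level `l` the key moves `d` to the front; the shift by one keeps it injective there. By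
    -- `hs`, the sibling condition on this level is vacuous.
    (fun i x => if i = l then (if (x : ℕ) = d then 0 else (x : ℕ) + 1) else mergeKey τ (l + 1) a i x)
    (fun i x y hp hxy hu => by
      by_cases hi : i = l
      · subst hi
        exact absurd (hs x y hp hu) hxy.ne
      · rw [Fin.lt_def] at hxy
        simp only [mergeKey, if_neg hi]
        split_ifs <;> omega)
    (by
      rw [if_neg (by omega), if_neg (by omega)]
      simp [mergeKey, hab])
    (fun i x y hxy h => by
      rw [Fin.lt_def] at hxy
      simp only [mergeKey] at h
      split_ifs at h <;> omega)
  refine ⟨θ, w, v, h1, h2, h3, fun c hc hp hu => not_le.1 fun hle => ?_⟩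
  have := (h4 l c d hp hu).1 hle
  simp only [if_true, Fin.ext_iff, ne_eq] at this hc
  simp [hc] at this

/-- Two factorizations of a morphism with the same identifications in the first step agree unless
the first steps order two vertices with the same final image differently. -/
theorem exists_inversion {w : τ ⟶ θ} {v : θ ⟶ σ} {w' : τ ⟶ θ'} {v' : θ' ⟶ σ}
    (h : w ≫ v = w' ≫ v')
    (hk : ∀ i x y, Hom.app w i x = Hom.app w i y ↔ Hom.app w' i x = Hom.app w' i y)
    (hne : ¬ ∀ i x y, Hom.app w i x ≤ Hom.app w i y → Hom.app w' i x ≤ Hom.app w' i y) :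
    ∃ i x y, τ.parent i x ≠ τ.parent i y ∧
      Hom.app w (i + 1) (τ.parent i x) = Hom.app w (i + 1) (τ.parent i y) ∧
      Hom.app w i x < Hom.app w i y ∧ Hom.app w' i y < Hom.app w' i x ∧
      Hom.app (w ≫ v) i x = Hom.app (w ≫ v) i y := by
  by_contra! hno
  refine hne (level_induction n ?_ ?_)
  · intro i hi x y _
    rw [eq_of_top τ hi x y]
  · intro i ih x y hxy
    by_contra! hyx
    have hp : Hom.app w (i + 1) (τ.parent i x) ≤ Hom.app w (i + 1) (τ.parent i y) := by
      rw [w.comm, w.comm]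
      exact θ.parent_mono i hxy
    have hp' : Hom.app w' (i + 1) (τ.parent i y) ≤ Hom.app w' (i + 1) (τ.parent i x) := by
      rw [w'.comm, w'.comm]
      exact θ'.parent_mono i hyx.le
    -- The orders agree one level up, so a reversal below forces the parents to have equal images.
    have hpe' := le_antisymm (ih _ _ hp) hp'
    have hpe := (hk _ _ _).2 hpe'
    have hlt : Hom.app w i x < Hom.app w i y :=
      lt_of_le_of_ne hxy fun e => hyx.ne ((hk _ _ _).1 e).symm
    -- Siblings cannot be reversed; the final images agree because `v` and `v'` are nondecreasing on
    -- fibres and see the pair in opposite orders.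
    refine hno i x y (fun hs => ?_) hpe hlt hyx ?_
    · rcases le_total x y with hle | hle
      · exact absurd (w'.mono i x y hs hle) hyx.not_ge
      · exact absurd (w.mono i y x hs.symm hle) hlt.not_ge
    · refine le_antisymm (v.mono i _ _ ?_ hlt.le) ?_
      · rw [← w.comm, ← w.comm, hpe]
      · rw [h]
        refine v'.mono i _ _ ?_ hyx.le
        rw [← w'.comm, ← w'.comm, hpe']

/-- Morphisms of degree one that fuse the same vertices have the same identifications. -/
theorem app_eq_iff_of_fuses {w : τ ⟶ θ} {w' : τ ⟶ θ'} (hw : Hom.degree w = 1)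
    (hw' : Hom.degree w' = 1) {k : ℕ} {a b : Fin (τ.size k)} (hf : Fuses w k a b)
    (hf' : Fuses w' k a b) (i : ℕ) (x y : Fin (τ.size i)) :
    Hom.app w i x = Hom.app w i y ↔ Hom.app w' i x = Hom.app w' i y := by
  have key : ∀ {θ θ' : PrunedTree n} (w : τ ⟶ θ) (w' : τ ⟶ θ'), Hom.degree w = 1 →
      Fuses w k a b → Fuses w' k a b → ∀ i x y,
      Hom.app w i x = Hom.app w i y → Hom.app w' i x = Hom.app w' i y := by
    intro θ θ' w w' hw hf hf' i x y h
    rcases lt_trichotomy x y with hxy | rfl | hxy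
    · obtain ⟨rfl, hx, hy⟩ := eq_of_app_eq hw hf.lt hf.2.2 hxy h
      rw [Fin.ext hx, Fin.ext hy, hf'.2.2]
    · rfl
    · obtain ⟨rfl, hx, hy⟩ := eq_of_app_eq hw hf.lt hf.2.2 hxy h.symm
      rw [Fin.ext hx, Fin.ext hy, hf'.2.2]
  exact ⟨key w w' hw hf hf' i x y, key w' w hw' hf' hf i x y⟩

end

end PrunedTree

/-! ### Morphisms of degree two -/

namespace PrunedTree

variable {n : ℕ} {τ θ θ' θ₁ θ₂ σ : PrunedTree n}

/-- The order of the vertices after `w` determines their order after `w'`. -/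
def OrderLE (w : τ ⟶ θ) (w' : τ ⟶ θ') : Prop :=
  ∀ i x y, Hom.app w i x ≤ Hom.app w i y → Hom.app w' i x ≤ Hom.app w' i y

theorem OrderLE.app_eq {w : τ ⟶ θ} {w' : τ ⟶ θ'} (h : OrderLE w w') {i : ℕ}
    {x y : Fin (τ.size i)} (hxy : Hom.app w i x = Hom.app w i y) :
    Hom.app w' i x = Hom.app w' i y :=
  le_antisymm (h _ _ _ hxy.le) (h _ _ _ hxy.ge)

theorem app_lt_of_siblings (w : τ ⟶ θ) {k : ℕ} {a b : Fin (τ.size k)} (hab : a < b)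
    (hp : τ.parent k a = τ.parent k b) (hne : Hom.app w k a ≠ Hom.app w k b) :
    Hom.app w k a < Hom.app w k b :=
  lt_of_le_of_ne (w.mono k a b hp hab.le) hne

/-- Siblings with consecutive images may be replaced by consecutive siblings. -/
theorem exists_consecutive (w : τ ⟶ θ) {k : ℕ} {c d : Fin (τ.size k)}
    (hp : τ.parent k c = τ.parent k d)
    (h : (Hom.app w k d : ℕ) = (Hom.app w k c : ℕ) + 1) :
    ∃ c' d' : Fin (τ.size k), (d' : ℕ) = (c' : ℕ) + 1 ∧ τ.parent k c' = τ.parent k d' ∧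
      Hom.app w k c' = Hom.app w k c ∧ Hom.app w k d' = Hom.app w k d := by
  have hcd : c < d := by
    by_contra hdc
    have := Fin.le_def.1 (w.mono k d c hp.symm (not_lt.1 hdc))
    omega
  -- Induction on `d - c`: the successor of `c` maps to the image of `c` or of `d`, as these are
  -- consecutive.
  have key : ∀ m (c : Fin (τ.size k)), c < d → (d : ℕ) - c = m → τ.parent k c = τ.parent k d →
      (Hom.app w k d : ℕ) = (Hom.app w k c : ℕ) + 1 →
      ∃ c' d' : Fin (τ.size k), (d' : ℕ) = (c' : ℕ) + 1 ∧ τ.parent k c' = τ.parent k d' ∧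
      Hom.app w k c' = Hom.app w k c ∧ Hom.app w k d' = Hom.app w k d := by
    intro m
    induction m with
    | zero => intro c hcd hm; rw [Fin.lt_def] at hcd; omega
    | succ m ih =>
      intro c hcd hm hp h
      rw [Fin.lt_def] at hcd
      let z : Fin (τ.size k) := ⟨c + 1, by omega⟩
      have hcz : c ≤ z := Fin.le_def.2 (by simp [z])
      have hzd : z ≤ d := Fin.le_def.2 (by simpa [z] using hcd)
      have hpz := parent_eq_of_mem hp hcz hzd
      have h1 := Fin.le_def.1 (w.mono k c z hpz hcz)
      have h2 := Fin.le_def.1 (w.mono k z d (hpz ▸ hp) hzd)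
      by_cases hz : Hom.app w k z = Hom.app w k d
      · exact ⟨c, z, rfl, hpz, rfl, hz⟩
      · have hz' : Hom.app w k z = Hom.app w k c :=
          Fin.ext (by rw [Fin.ext_iff] at hz; omega)
        have hne : (z : ℕ) ≠ d := fun e => hz (by rw [Fin.ext e])
        have hle := Fin.le_def.1 hzd
        obtain ⟨c', d', h3, h4, h5, h6⟩ := ih z (Fin.lt_def.2 (by omega)) (by simp [z]; omega)
          (hpz ▸ hp) (by rw [hz', h])
        exact ⟨c', d', h3, h4, h5.trans hz', h6⟩
  exact key _ c hcd rfl hp h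

/-- If a morphism identifies only siblings, then its factors of degree one are determined by the
vertices they fuse. -/
theorem orderLE_of_fuses {w : τ ⟶ θ} {v : θ ⟶ σ} {w' : τ ⟶ θ'} {v' : θ' ⟶ σ}
    (h : w ≫ v = w' ≫ v') (hw : Hom.degree w = 1) (hw' : Hom.degree w' = 1) {k : ℕ}
    {a b : Fin (τ.size k)} (hf : Fuses w k a b) (hf' : Fuses w' k a b)
    (hs : ∀ i x y, Hom.app (w ≫ v) i x = Hom.app (w ≫ v) i y →
      τ.parent i x = τ.parent i y) : OrderLE w w' := by
  by_contra hne
  obtain ⟨i, x, y, h1, -, -, -, h2⟩ := exists_inversion h (app_eq_iff_of_fuses hw hw' hf hf') hne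
  exact h1 (hs i x y h2)

theorem exists_fuses_of_degree_eq_one {w : τ ⟶ θ} (hw : Hom.degree w = 1) :
    ∃ (k : ℕ) (a b : Fin (τ.size k)), Fuses w k a b := exists_fuses (by omega)

theorem Fuses.comp {w : τ ⟶ θ} (v : θ ⟶ σ) {k : ℕ} {a b : Fin (τ.size k)}
    (h : Fuses w k a b) : Fuses (w ≫ v) k a b :=
  ⟨h.1, h.2.1, by rw [comp_app, comp_app, h.2.2]⟩

/-- Squares of one of the three types. -/
def IsQuadratic (w₁ : τ ⟶ θ₁) (v₁ : θ₁ ⟶ σ) (w₂ : τ ⟶ θ₂) (v₂ : θ₂ ⟶ σ) : Prop :=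
  ConsecutiveMerging w₁ v₁ w₂ v₂ ∨ DisjointMerging w₁ v₁ w₂ v₂ ∨ NestedMerging w₁ v₁ w₂ v₂

/-- The second step after a morphism of degree one that keeps siblings apart which are
identified in the end. -/
theorem fuses_image {w : τ ⟶ θ} {v : θ ⟶ σ} (hv : Hom.degree v = 1) {k : ℕ}
    {a b : Fin (τ.size k)} (hf : Fuses (w ≫ v) k a b) (hne : Hom.app w k a ≠ Hom.app w k b) :
    Fuses v k (Hom.app w k a) (Hom.app w k b) :=
  fuses_of_lt hv (app_lt_of_siblings w hf.lt hf.2.1 hne) hf.2.2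

/-- The two factorizations when two pairs of siblings are identified. -/
theorem isQuadratic_of_siblings {w₁ : τ ⟶ θ₁} {v₁ : θ₁ ⟶ σ} {w₂ : τ ⟶ θ₂} {v₂ : θ₂ ⟶ σ}
    (h : w₁ ≫ v₁ = w₂ ≫ v₂) (hv₁ : Hom.degree v₁ = 1) (hv₂ : Hom.degree v₂ = 1)
    {k l : ℕ} {a b : Fin (τ.size k)} {c d : Fin (τ.size l)}
    (hf₁ : Fuses w₁ k a b) (hf₂ : Fuses w₂ l c d)
    (hcd : Hom.app w₁ l c ≠ Hom.app w₁ l d) (hab : Hom.app w₂ k a ≠ Hom.app w₂ k b) :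
    IsQuadratic w₁ v₁ w₂ v₂ ∨ IsQuadratic w₂ v₂ w₁ v₁ := by
  have g₁ := fuses_image hv₁ (h ▸ hf₂.comp v₂) hcd
  have g₂ := fuses_image hv₂ (h ▸ hf₁.comp v₁) hab
  by_cases hd : k = l → (b : ℕ) < (c : ℕ) ∨ (d : ℕ) < (a : ℕ)
  · exact Or.inl (Or.inr (Or.inl ⟨k, l, a, b, c, d, hd, hf₁, g₁, hf₂, g₂⟩))
  · obtain ⟨rfl, hd⟩ := not_forall.1 hd
    have e₁ := hf₁.1
    have e₂ := hf₂.1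
    -- Distinct pairs of consecutive vertices that are not disjoint share one vertex. Which one it
    -- is decides the order of the two sides of the square.
    have hac : (a : ℕ) ≠ c := fun e => hcd (by
      rw [← Fin.ext e, ← (Fin.ext (by omega) : b = d)]
      exact hf₁.2.2)
    have : (b : ℕ) = c ∨ (d : ℕ) = a := by omega
    rcases this with e | e
    · obtain rfl := Fin.ext e
      exact Or.inl (Or.inl ⟨k, a, b, d, hf₁, g₁, hf₂, g₂⟩)
    · obtain rfl := Fin.ext e
      exact Or.inr (Or.inl ⟨k, c, d, b, hf₂, g₂, hf₁, g₁⟩)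

/-- Every morphism of degree two has exactly two factorizations into morphisms of degree one. -/
theorem exists_isQuadratic (u : τ ⟶ σ) (hu : Hom.degree u = 2) :
    ∃ (θ₁ θ₂ : PrunedTree n) (w₁ : τ ⟶ θ₁) (v₁ : θ₁ ⟶ σ) (w₂ : τ ⟶ θ₂) (v₂ : θ₂ ⟶ σ),
      Hom.degree w₁ = 1 ∧ Hom.degree w₂ = 1 ∧ w₁ ≫ v₁ = u ∧ w₂ ≫ v₂ = u ∧
      IsQuadratic w₁ v₁ w₂ v₂ ∧ ¬ OrderLE w₁ w₂ ∧
      ∀ (θ : PrunedTree n) (w : τ ⟶ θ) (v : θ ⟶ σ), Hom.degree w = 1 → w ≫ v = u →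
        OrderLE w₁ w ∨ OrderLE w₂ w := by
  obtain ⟨k, a, b, hab⟩ := exists_fuses (w := u) (by omega)
  obtain ⟨θ₁, w₁, v₁, rfl, hw₁, hf₁⟩ := exists_factorization u hab
  have hv₁ : Hom.degree v₁ = 1 := by rw [degree_comp] at hu; omega
  obtain ⟨l, c', d', hcd'⟩ := exists_fuses_of_degree_eq_one hv₁
  have hker : ∀ i x y, Hom.app (w₁ ≫ v₁) i x = Hom.app (w₁ ≫ v₁) i y →
      Hom.app w₁ i x < Hom.app w₁ i y →
      i = l ∧ (Hom.app w₁ i x : ℕ) = c' ∧ (Hom.app w₁ i y : ℕ) = d' := fun i x y h hxy =>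
    eq_of_app_eq hv₁ hcd'.lt hcd'.2.2 hxy h
  -- The dichotomy between types 1, 2 and type 3: whether the pair fused second lifts to siblings of
  -- `τ`.
  by_cases hsib : ∃ c d, Hom.app w₁ l c = c' ∧ Hom.app w₁ l d = d' ∧
      τ.parent l c = τ.parent l d
  · obtain ⟨c₀, d₀, rfl, rfl, hp₀⟩ := hsib
    obtain ⟨c, d, hcd, hp, hc, hd⟩ := exists_consecutive w₁ hp₀ hcd'.1
    rw [← hc, ← hd] at hcd' hker
    clear hc hd hp₀ c₀ d₀
    have hfu : Fuses (w₁ ≫ v₁) l c d := ⟨hcd, hp, hcd'.2.2⟩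
    obtain ⟨θ₂, w₂, v₂, he, hw₂, hf₂⟩ := exists_factorization _ hfu
    have hv₂ : Hom.degree v₂ = 1 := by rw [← he, degree_comp] at hu; omega
    have hne₁ : Hom.app w₁ l c ≠ Hom.app w₁ l d := hcd'.lt.ne
    have hne₂ : Hom.app w₂ k a ≠ Hom.app w₂ k b := fun e => by
      obtain ⟨rfl, ha, hb⟩ := eq_of_app_eq hw₂ hf₂.lt hf₂.2.2 hf₁.lt e
      obtain rfl := Fin.ext ha
      obtain rfl := Fin.ext hb
      exact hne₁ hf₁.2.2
    -- Only siblings are identified in the end, so a first step is determined by the pair it fuses.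
    have hs : ∀ i x y, Hom.app (w₁ ≫ v₁) i x = Hom.app (w₁ ≫ v₁) i y →
        τ.parent i x = τ.parent i y := by
      have key : ∀ i x y, Hom.app (w₁ ≫ v₁) i x = Hom.app (w₁ ≫ v₁) i y →
          Hom.app w₁ i x < Hom.app w₁ i y → τ.parent i x = τ.parent i y := fun i x y h hxy => by
        obtain ⟨rfl, hx, hy⟩ := hker i x y h hxy
        rw [parent_eq_of_app_eq hw₁ (Fin.ext hx), hp, parent_eq_of_app_eq hw₁ (Fin.ext hy)]
      intro i x y h
      rcases lt_trichotomy (Hom.app w₁ i x) (Hom.app w₁ i y) with hxy | hxy | hxy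
      · exact key i x y h hxy
      · exact parent_eq_of_app_eq hw₁ hxy
      · exact (key i y x h.symm hxy).symm
    have hall : ∀ (θ : PrunedTree n) (w : τ ⟶ θ) (v : θ ⟶ σ), Hom.degree w = 1 →
        w ≫ v = w₁ ≫ v₁ → OrderLE w₁ w ∨ OrderLE w₂ w := by
      intro θ w v hw h
      obtain ⟨j, x, y, hf⟩ := exists_fuses_of_degree_eq_one hw
      have hfu := h ▸ hf.comp v
      by_cases hxy : Hom.app w₁ j x = Hom.app w₁ j y
      · left
        obtain ⟨rfl, hx, hy⟩ := eq_of_app_eq hw₁ hf₁.lt hf₁.2.2 hf.lt hxy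
        obtain rfl := Fin.ext hx
        obtain rfl := Fin.ext hy
        exact orderLE_of_fuses h.symm hw₁ hw hf₁ hf hs
      · right
        obtain ⟨rfl, hx, hy⟩ := hker j x y hfu.2.2 (app_lt_of_siblings w₁ hf.lt hf.2.1 hxy)
        -- If `x ≠ c`, then `w₁` identifies `x` with `c` and also `y` with `d`; since it identifies
        -- a single pair, `x = y`, which is absurd.
        have hxc : x = c := by
          have e := hf.1
          rcases lt_trichotomy x c with hlt | heq | hlt
          · have := eq_of_app_eq hw₁ hlt (Fin.ext hx) (x := y) (y := d)
              (by rw [Fin.lt_def] at hlt ⊢; omega) (Fin.ext hy)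
            omega
          · exact heq
          · have := eq_of_app_eq hw₁ hlt (Fin.ext hx).symm (x := d) (y := y)
              (by rw [Fin.lt_def] at hlt ⊢; omega) (Fin.ext hy).symm
            omega
        obtain rfl := hxc
        obtain rfl : y = d := Fin.ext (by rw [hf.1, hcd])
        exact orderLE_of_fuses (he.trans h.symm) hw₂ hw hf₂ hf (he ▸ hs)
    rcases isQuadratic_of_siblings he.symm hv₁ hv₂ hf₁ hf₂ hne₁ hne₂ with hq | hq
    · exact ⟨θ₁, θ₂, w₁, v₁, w₂, v₂, hw₁, hw₂, rfl, he, hq, fun e => hne₂ (e.app_eq hf₁.2.2),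
        hall⟩
    · exact ⟨θ₂, θ₁, w₂, v₂, w₁, v₁, hw₂, hw₁, he, rfl, hq, fun e => hne₁ (e.app_eq hf₂.2.2),
        fun θ w v hw h => (hall θ w v hw h).symm⟩
  · obtain ⟨c, rfl⟩ := w₁.app_surj l c'
    obtain ⟨d, rfl⟩ := w₁.app_surj l d'
    have hpcd : τ.parent l c ≠ τ.parent l d := fun e => hsib ⟨c, d, rfl, rfl, e⟩
    have hpw : Hom.app w₁ (l + 1) (τ.parent l c) = Hom.app w₁ (l + 1) (τ.parent l d) := by
      rw [w₁.comm, w₁.comm]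
      exact hcd'.2.1
    -- The distinct parents of `c` and `d` are identified by `w₁`, so they are `a` and `b` in some
    -- order.
    obtain ⟨rfl, hcd⟩ : l + 1 = k ∧
        ((τ.parent l c : ℕ) = a ∧ (τ.parent l d : ℕ) = b ∨
          (τ.parent l d : ℕ) = a ∧ (τ.parent l c : ℕ) = b) := by
      rcases hpcd.lt_or_gt with hlt | hlt
      · obtain ⟨h1, h2⟩ := eq_of_app_eq hw₁ hf₁.lt hf₁.2.2 hlt hpw
        exact ⟨h1, Or.inl h2⟩
      · obtain ⟨h1, h2⟩ := eq_of_app_eq hw₁ hf₁.lt hf₁.2.2 hlt hpw.symm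
        exact ⟨h1, Or.inr h2⟩
    have hinj : ∀ i, i ≠ l + 1 → Function.Injective (Hom.app w₁ i) := by
      intro i hi x y h
      rcases lt_trichotomy x y with hxy | hxy | hxy
      · exact absurd (eq_of_app_eq hw₁ hf₁.lt hf₁.2.2 hxy h).1 hi
      · exact hxy
      · exact absurd (eq_of_app_eq hw₁ hf₁.lt hf₁.2.2 hxy h.symm).1 hi
    have hker' : ∀ i x y, Hom.app (w₁ ≫ v₁) i x = Hom.app (w₁ ≫ v₁) i y →
        Hom.app w₁ i x ≠ Hom.app w₁ i y → ∃ h : i = l,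
          (h ▸ x = c ∧ h ▸ y = d) ∨ (h ▸ x = d ∧ h ▸ y = c) := by
      intro i x y h hne
      rcases hne.lt_or_gt with hlt | hlt
      · obtain ⟨rfl, hx, hy⟩ := hker i x y h hlt
        exact ⟨rfl, Or.inl ⟨hinj i (by omega) (Fin.ext hx), hinj i (by omega) (Fin.ext hy)⟩⟩
      · obtain ⟨rfl, hx, hy⟩ := hker i y x h.symm hlt
        exact ⟨rfl, Or.inr ⟨hinj i (by omega) (Fin.ext hy), hinj i (by omega) (Fin.ext hx)⟩⟩
    have hns : ∀ i x y, τ.parent i x = τ.parent i y →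
        Hom.app (w₁ ≫ v₁) i x = Hom.app (w₁ ≫ v₁) i y → Hom.app w₁ i x = Hom.app w₁ i y := by
      intro i x y hp h
      by_contra hne
      obtain ⟨rfl, ⟨rfl, rfl⟩ | ⟨rfl, rfl⟩⟩ := hker' i x y h hne
      · exact hpcd hp
      · exact hpcd hp.symm
    -- The second factorization fuses `a`, `b` again but places `d` before `c`, against the order
    -- chosen by `w₁`.
    obtain ⟨θ₂, w₂, v₂, he, hw₂, hf₂, hpl⟩ := exists_factorization_placing (w₁ ≫ v₁) hab d
      fun x y hp h => hinj l (by omega) (hns l x y hp h)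
    have hv₂ : Hom.degree v₂ = 1 := by rw [← he, degree_comp] at hu; omega
    have hk₁₂ := app_eq_iff_of_fuses hw₁ hw₂ hf₁ hf₂
    have hlt₂ : Hom.app w₂ l d < Hom.app w₂ l c :=
      hpl c (fun e => hpcd (by rw [e])) ((hk₁₂ _ _ _).1 hpw) hcd'.2.2
    have hg₂ : Fuses v₂ l (Hom.app w₂ l d) (Hom.app w₂ l c) := by
      refine fuses_of_lt hv₂ hlt₂ ?_
      rw [← comp_app, ← comp_app, he]
      exact hcd'.2.2.symm
    have hlt₁ : Hom.app w₁ l c < Hom.app w₁ l d := hcd'.lt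
    have hall : ∀ (θ : PrunedTree n) (w : τ ⟶ θ) (v : θ ⟶ σ), Hom.degree w = 1 →
        w ≫ v = w₁ ≫ v₁ → OrderLE w₁ w ∨ OrderLE w₂ w := by
      intro θ w v hw h
      obtain ⟨j, x, y, hf⟩ := exists_fuses_of_degree_eq_one hw
      have hfu := h ▸ hf.comp v
      obtain ⟨rfl, hx, hy⟩ := eq_of_app_eq hw₁ hf₁.lt hf₁.2.2 hf.lt (hns _ _ _ hfu.2.1 hfu.2.2)
      obtain rfl := Fin.ext hx
      obtain rfl := Fin.ext hy
      by_contra! hne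
      have hk₁ := app_eq_iff_of_fuses hw₁ hw hf₁ hf
      have hk₂ := app_eq_iff_of_fuses hw₂ hw hf₂ hf
      have hpne : ∀ i x y, τ.parent i x ≠ τ.parent i y →
          Hom.app (w₁ ≫ v₁) i x = Hom.app (w₁ ≫ v₁) i y → Hom.app w₁ i x ≠ Hom.app w₁ i y :=
        fun i x y hp _ e => hp (parent_eq_of_app_eq hw₁ e)
      -- A third factorization would disagree with both `w₁` and `w₂` on the order of `c` and `d`,
      -- the only available pair; but these two orders are opposite.
      obtain ⟨i, x, y, hp, -, h1, h2, h3⟩ := exists_inversion h.symm hk₁ hne.1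
      obtain ⟨i', x', y', hp', -, h1', h2', h3'⟩ := exists_inversion (he.trans h.symm) hk₂ hne.2
      rw [he] at h3'
      obtain ⟨rfl, ⟨rfl, rfl⟩ | ⟨rfl, rfl⟩⟩ := hker' i x y h3 (hpne i x y hp h3)
      · obtain ⟨rfl, ⟨rfl, rfl⟩ | ⟨rfl, rfl⟩⟩ := hker' i' x' y' h3' (hpne i' x' y' hp' h3')
        · exact lt_asymm hlt₂ h1'
        · exact lt_asymm h2 h2'
      · exact lt_asymm hlt₁ h1
    have hne : ∀ {θ θ' : PrunedTree n} {w : τ ⟶ θ} {w' : τ ⟶ θ'} {x y : Fin (τ.size l)},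
        Hom.app w l x < Hom.app w l y → Hom.app w' l y < Hom.app w' l x → ¬ OrderLE w w' :=
      fun h h' hle => (hle _ _ _ h.le).not_gt h'
    rcases hcd with ⟨hc, hd⟩ | ⟨hd, hc⟩
    · exact ⟨θ₁, θ₂, w₁, v₁, w₂, v₂, hw₁, hw₂, rfl, he,
        Or.inr (Or.inr ⟨l, a, b, c, d, Fin.ext hc, Fin.ext hd, hf₁, hcd', hf₂, hg₂⟩),
        hne hlt₁ hlt₂, hall⟩
    · exact ⟨θ₂, θ₁, w₂, v₂, w₁, v₁, hw₂, hw₁, he, rfl,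
        Or.inr (Or.inr ⟨l, a, b, d, c, Fin.ext hd, Fin.ext hc, hf₂, hg₂, hf₁, hcd'⟩),
        hne hlt₂ hlt₁, fun θ w v hw h => (hall θ w v hw h).symm⟩

end PrunedTree

/-! ### Connecting factorizations by squares -/

namespace PrunedTree

variable {n : ℕ} {τ θ θ' σ : PrunedTree n}

/-- A factorization of a morphism whose first step has degree one. -/
structure Atom (u : τ ⟶ σ) where
  tree : PrunedTree n
  fst : τ ⟶ tree
  snd : tree ⟶ σ
  comp_eq : fst ≫ snd = u
  degree_fst : Hom.degree fst = 1

namespace Atom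

variable {u : τ ⟶ σ}

/-- The order comparison yields a morphism between the middle trees. Its degree is zero, so it is an
identity, and the second factors agree because levelwise surjections can be cancelled. -/
theorem eq_of_orderLE (A B : Atom u) (h : OrderLE A.fst B.fst) : A = B := by
  obtain ⟨e, he⟩ := exists_comp_eq A.fst B.fst fun i x y _ hxy => h i x y hxy
  have hd : Hom.degree e = 0 := by
    have := congrArg Hom.degree he
    rw [degree_comp, A.degree_fst, B.degree_fst] at this
    omega
  obtain ⟨θ, w, v, hwv, hw⟩ := A
  obtain ⟨θ', w', v', hwv', hw'⟩ := B
  dsimp only at he e hd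
  clear h
  refine degree_zero_induction (P := fun θ' e => ∀ (w' : τ ⟶ θ') (v' : θ' ⟶ σ)
    (hwv' : w' ≫ v' = u) (hw' : Hom.degree w' = 1), w ≫ e = w' →
    (⟨θ, w, v, hwv, hw⟩ : Atom u) = ⟨θ', w', v', hwv', hw'⟩) ?_ e hd w' v' hwv' hw' he
  intro w' v' hwv' hw' he
  rw [Category.comp_id] at he
  subst he
  obtain rfl := eq_of_comp_eq w (hwv.trans hwv'.symm)
  rfl

/-- Two factorizations are adjacent if their first steps are the first steps of the two sides of a
square. -/
def Adj (A B : Atom u) : Prop :=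
  ∃ (ρ : PrunedTree n) (z : A.tree ⟶ ρ) (z' : B.tree ⟶ ρ) (r : ρ ⟶ σ),
    A.fst ≫ z = B.fst ≫ z' ∧ Hom.degree z = 1 ∧ Hom.degree z' = 1 ∧
      z ≫ r = A.snd ∧ z' ≫ r = B.snd

end Atom

/-- A factorization of a morphism of degree two is not the only one. -/
theorem exists_not_orderLE (w : τ ⟶ θ) (z : θ ⟶ σ) (hw : Hom.degree w = 1)
    (hz : Hom.degree z = 1) :
    ∃ (θ' : PrunedTree n) (w' : τ ⟶ θ') (z' : θ' ⟶ σ), Hom.degree w' = 1 ∧ w' ≫ z' = w ≫ z ∧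
      ¬ OrderLE w w' := by
  obtain ⟨θ₁, θ₂, w₁, v₁, w₂, v₂, hw₁, hw₂, h₁, h₂, -, hne, hall⟩ :=
    exists_isQuadratic (w ≫ z) (by rw [degree_comp]; omega)
  rcases hall θ w z hw rfl with h | h
  · exact ⟨θ₂, w₂, v₂, hw₂, h₂, fun h' => hne fun i x y hxy => h' _ _ _ (h _ _ _ hxy)⟩
  · refine ⟨θ₁, w₁, v₁, hw₁, h₁, fun h' => hne ?_⟩
    -- Here `w` is the second first step; if it also agreed with `w₁`, the two factorizations would
    -- coincide.
    have e : (⟨θ₂, w₂, v₂, h₂, hw₂⟩ : Atom (w ≫ z)) = ⟨θ₁, w₁, v₁, h₁, hw₁⟩ :=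
      (Atom.eq_of_orderLE _ ⟨θ, w, z, rfl, hw⟩ h).trans (Atom.eq_of_orderLE _ _ h')
    injection e with e₁ e₂
    subst e₁
    obtain rfl := eq_of_heq e₂
    exact fun i x y hxy => hxy

/-- Among the vertices that are ordered differently by two morphisms there are two that become
consecutive. -/
theorem exists_consecutive_inversion (w : τ ⟶ θ) (w' : τ ⟶ θ') {i : ℕ} {x y : Fin (τ.size i)}
    (hp : Hom.app w (i + 1) (τ.parent i x) = Hom.app w (i + 1) (τ.parent i y))
    (h : Hom.app w i x < Hom.app w i y) (h' : Hom.app w' i y < Hom.app w' i x) :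
    ∃ x y, Hom.app w (i + 1) (τ.parent i x) = Hom.app w (i + 1) (τ.parent i y) ∧
      (Hom.app w i y : ℕ) = (Hom.app w i x : ℕ) + 1 ∧ Hom.app w' i y < Hom.app w' i x := by
  have key : ∀ m x y, (Hom.app w i y : ℕ) - Hom.app w i x = m →
      Hom.app w (i + 1) (τ.parent i x) = Hom.app w (i + 1) (τ.parent i y) →
      Hom.app w i x < Hom.app w i y → Hom.app w' i y < Hom.app w' i x →
      ∃ x y, Hom.app w (i + 1) (τ.parent i x) = Hom.app w (i + 1) (τ.parent i y) ∧
        (Hom.app w i y : ℕ) = (Hom.app w i x : ℕ) + 1 ∧ Hom.app w' i y < Hom.app w' i x := by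
    intro m
    induction m using Nat.strong_induction_on with
    | h m ih =>
      intro x y hm hp h h'
      have hlt := Fin.lt_def.1 h
      by_cases hc : (Hom.app w i y : ℕ) = (Hom.app w i x : ℕ) + 1
      · exact ⟨x, y, hp, hc, h'⟩
      · obtain ⟨z, hz⟩ := w.app_surj i ⟨Hom.app w i x + 1, by omega⟩
        have hz' : (Hom.app w i z : ℕ) = Hom.app w i x + 1 := by rw [hz]
        have hxz : Hom.app w i x < Hom.app w i z := Fin.lt_def.2 (by omega)
        have hzy : Hom.app w i z < Hom.app w i y := Fin.lt_def.2 (by omega)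
        have hpz : Hom.app w (i + 1) (τ.parent i x) = Hom.app w (i + 1) (τ.parent i z) := by
          rw [w.comm, w.comm] at hp ⊢
          exact parent_eq_of_mem hp hxz.le hzy.le
        -- Wherever `w'` puts the intermediate `z`, one of the closer pairs `(x, z)`, `(z, y)` is
        -- inverted.
        rcases lt_or_ge (Hom.app w' i z) (Hom.app w' i x) with hlt' | hge
        · exact ih _ (by omega) x z rfl hpz hxz hlt'
        · exact ih _ (by omega) z y rfl (hpz ▸ hp) hzy (h'.trans_le hge)
  exact key _ x y rfl hp h h'

namespace Atom

variable {u : τ ⟶ σ}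

theorem app_eq (A : Atom u) (i : ℕ) (x : Fin (τ.size i)) :
    Hom.app A.snd i (Hom.app A.fst i x) = Hom.app u i x := by
  rw [← comp_app, A.comp_eq]

/-- Two vertices with a common parent that are ordered differently by two factors of a
morphism have the same final image. -/
theorem app_eq_of_inversion (A B : Atom u) {i : ℕ} {x y : Fin (τ.size i)}
    (hA : Hom.app A.fst (i + 1) (τ.parent i x) = Hom.app A.fst (i + 1) (τ.parent i y))
    (hB : Hom.app B.fst (i + 1) (τ.parent i x) = Hom.app B.fst (i + 1) (τ.parent i y))
    (h : Hom.app A.fst i x ≤ Hom.app A.fst i y) (h' : Hom.app B.fst i y ≤ Hom.app B.fst i x) :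
    Hom.app u i x = Hom.app u i y := by
  rw [A.fst.comm, A.fst.comm] at hA
  rw [B.fst.comm, B.fst.comm] at hB
  have h1 := A.snd.mono i _ _ hA h
  have h2 := B.snd.mono i _ _ hB.symm h'
  rw [A.app_eq, A.app_eq] at h1
  rw [B.app_eq, B.app_eq] at h2
  exact le_antisymm h1 h2

/-- The pairs of vertices of level `i` that obtain a common parent and are ordered differently
by two factors. -/
def inversions (A B : Atom u) (i : ℕ) : Finset (Fin (τ.size i) × Fin (τ.size i)) :=
  {s | Hom.app B.fst (i + 1) (τ.parent i s.1) = Hom.app B.fst (i + 1) (τ.parent i s.2) ∧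
    Hom.app A.fst i s.1 < Hom.app A.fst i s.2 ∧ Hom.app B.fst i s.2 < Hom.app B.fst i s.1}

/-- One step of the bubble sort. The inverted `x`, `y` have the same image under `u`, so they can be
merged right after `A.fst`; the other factorization of the resulting morphism of degree two
exchanges them. -/
theorem exists_adj_of_inversion (A B : Atom u) {i : ℕ} {a b : Fin (τ.size (i + 1))}
    (hA : Fuses A.fst (i + 1) a b) (hB : Fuses B.fst (i + 1) a b) {x y : Fin (τ.size i)}
    (hp : Hom.app A.fst (i + 1) (τ.parent i x) = Hom.app A.fst (i + 1) (τ.parent i y))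
    (hxy : (Hom.app A.fst i y : ℕ) = (Hom.app A.fst i x : ℕ) + 1)
    (hyx : Hom.app B.fst i y < Hom.app B.fst i x) :
    ∃ C : Atom u, Adj A C ∧ Fuses C.fst (i + 1) a b ∧
      (inversions C B i).card < (inversions A B i).card := by
  have hk := app_eq_iff_of_fuses A.degree_fst B.degree_fst hA hB
  have hinj : Function.Injective (Hom.app A.fst i) := by
    intro s t h
    rcases lt_trichotomy s t with hst | hst | hst
    · exact absurd (eq_of_app_eq A.degree_fst hA.lt hA.2.2 hst h).1 (by omega)
    · exact hst
    · exact absurd (eq_of_app_eq A.degree_fst hA.lt hA.2.2 hst h.symm).1 (by omega)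
  have hlt : Hom.app A.fst i x < Hom.app A.fst i y := Fin.lt_def.2 (by omega)
  have hpxy : τ.parent i x ≠ τ.parent i y := fun h => by
    rcases le_total x y with hle | hle
    · exact absurd (B.fst.mono i x y h hle) hyx.not_ge
    · exact absurd (A.fst.mono i y x h.symm hle) hlt.not_ge
  have hv : Fuses A.snd i (Hom.app A.fst i x) (Hom.app A.fst i y) := by
    refine ⟨hxy, ?_, ?_⟩
    · rw [← A.fst.comm, ← A.fst.comm, hp]
    · rw [A.app_eq, A.app_eq]
      exact app_eq_of_inversion A B hp ((hk _ _ _).1 hp) hlt.le hyx.le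
  obtain ⟨ρ, z, r, hr, hz, hzf⟩ := exists_factorization A.snd hv
  obtain ⟨θ', w, z', hw, hwz, hne⟩ := exists_not_orderLE A.fst z A.degree_fst hz
  have hz' : Hom.degree z' = 1 := by
    have := congrArg Hom.degree hwz
    rw [degree_comp, degree_comp, A.degree_fst, hw, hz] at this
    omega
  have hker : ∀ j s t, Hom.app (A.fst ≫ z) j s = Hom.app (A.fst ≫ z) j t →
      Hom.app A.fst j s < Hom.app A.fst j t → ∃ e : j = i, e ▸ s = x ∧ e ▸ t = y := by
    intro j s t h hst
    obtain ⟨rfl, hs, ht⟩ := eq_of_app_eq hz hzf.lt hzf.2.2 hst h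
    exact ⟨rfl, hinj (Fin.ext hs), hinj (Fin.ext ht)⟩
  -- Besides the pair `a`, `b`, only `x` and `y` get identified, and they are not siblings; so `w`
  -- must fuse `a` and `b`.
  have hf : Fuses w (i + 1) a b := by
    obtain ⟨j, s, t, hf⟩ := exists_fuses_of_degree_eq_one hw
    have hfu := hwz ▸ hf.comp z'
    by_cases he : Hom.app A.fst j s = Hom.app A.fst j t
    · obtain ⟨rfl, hs, ht⟩ := eq_of_app_eq A.degree_fst hA.lt hA.2.2 hf.lt he
      obtain rfl := Fin.ext hs
      obtain rfl := Fin.ext ht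
      exact hf
    · obtain ⟨rfl, rfl, rfl⟩ := hker j s t hfu.2.2 (app_lt_of_siblings A.fst hf.lt hf.2.1 he)
      exact absurd hf.2.1 hpxy
  have hwk := app_eq_iff_of_fuses A.degree_fst hw hA hf
  have hwyx : Hom.app w i y < Hom.app w i x := by
    obtain ⟨j, s, t, -, -, h1, h2, h3⟩ := exists_inversion hwz.symm hwk hne
    obtain ⟨rfl, rfl, rfl⟩ := hker j s t h3 h1
    exact h2
  refine ⟨⟨θ', w, z' ≫ r, ?_, hw⟩, ⟨ρ, z, z', r, hwz.symm, hz, hz', hr, rfl⟩, hf, ?_⟩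
  · rw [← Category.assoc, hwz, Category.assoc, hr, A.comp_eq]
  -- No new inversion arises, as only `x` and `y` could change order, and the inversion `(x, y)`
  -- disappears.
  refine Finset.card_lt_card (Finset.ssubset_iff_subset_ne.2 ⟨?_, fun e => ?_⟩)
  · rintro ⟨s, t⟩ hst
    simp only [inversions, Finset.mem_filter, Finset.mem_univ, true_and] at hst ⊢
    obtain ⟨h1, h2, h3⟩ := hst
    refine ⟨h1, not_le.1 fun hts => ?_, h3⟩
    have hA' := (hk _ _ _).2 h1
    have hlt' : Hom.app A.fst i t < Hom.app A.fst i s :=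
      lt_of_le_of_ne hts fun e => h3.ne ((hk _ _ _).1 e)
    have h4 : Hom.app (A.fst ≫ z) i t = Hom.app (A.fst ≫ z) i s :=
      app_eq_of_inversion ⟨_, A.fst, z, rfl, A.degree_fst⟩ ⟨_, w, z', hwz, hw⟩ hA'.symm
        ((hwk _ _ _).1 hA'.symm) hts h2.le
    obtain ⟨_, rfl, rfl⟩ := hker i t s h4 hlt'
    exact lt_asymm h3 hyx
  · have : (x, y) ∈ inversions A B i := by
      simp only [inversions, Finset.mem_filter, Finset.mem_univ, true_and]
      exact ⟨(hk _ _ _).1 hp, hlt, hyx⟩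
    rw [← e] at this
    simp only [inversions, Finset.mem_filter, Finset.mem_univ, true_and] at this
    exact lt_asymm hwyx this.2.1

/-- Factorizations whose first steps fuse the same vertices are connected by squares. -/
theorem eqvGen_of_fuses (B : Atom u) {k : ℕ} {a b : Fin (τ.size k)} (hB : Fuses B.fst k a b)
    (A : Atom u) (hA : Fuses A.fst k a b) : Relation.EqvGen Adj A B := by
  have hstep : ∀ A : Atom u, Fuses A.fst k a b → A ≠ B → ∃ i, i + 1 = k ∧ ∃ x y,
      Hom.app A.fst (i + 1) (τ.parent i x) = Hom.app A.fst (i + 1) (τ.parent i y) ∧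
      (Hom.app A.fst i y : ℕ) = (Hom.app A.fst i x : ℕ) + 1 ∧
      Hom.app B.fst i y < Hom.app B.fst i x := by
    intro A hA hne
    obtain ⟨i, x, y, hpne, hp, h1, h2, -⟩ := exists_inversion (A.comp_eq.trans B.comp_eq.symm)
      (app_eq_iff_of_fuses A.degree_fst B.degree_fst hA hB)
      fun h => hne (eq_of_orderLE A B h)
    refine ⟨i, ?_, exists_consecutive_inversion A.fst B.fst hp h1 h2⟩
    rcases hpne.lt_or_gt with h | h
    · exact (eq_of_app_eq A.degree_fst hA.lt hA.2.2 h hp).1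
    · exact (eq_of_app_eq A.degree_fst hA.lt hA.2.2 h hp.symm).1
  -- Inversions on the level just below `k` are counted. For `k = 0` the truncated subtraction is
  -- harmless, since `hstep` then gives `A = B`.
  have key : ∀ m (A : Atom u), Fuses A.fst k a b → (inversions A B (k - 1)).card = m →
      Relation.EqvGen Adj A B := by
    intro m
    induction m using Nat.strong_induction_on with
    | h m ih =>
      intro A hA hm
      by_cases hAB : A = B
      · rw [hAB]
        exact Relation.EqvGen.refl _
      · obtain ⟨i, rfl, x, y, hp, hxy, hyx⟩ := hstep A hA hAB
        obtain ⟨C, hAC, hC, hlt⟩ := exists_adj_of_inversion A B hA hB hp hxy hyx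
        exact (Relation.EqvGen.rel _ _ hAC).trans _ _ _ (ih _ (hm ▸ hlt) C hC rfl)
  exact key _ A hA rfl

/-- As `l ≤ k`, the first step of `A` is injective above level `k`, hence nondecreasing on level
`k`. So `a` and `b`, if not yet identified, stay consecutive and can be fused next; the other side
of this square fuses them first, as `B` does. -/
theorem eqvGen_of_le (A B : Atom u) {k l : ℕ} {c d : Fin (τ.size l)} {a b : Fin (τ.size k)}
    (hA : Fuses A.fst l c d) (hB : Fuses B.fst k a b) (hlk : l ≤ k) :
    Relation.EqvGen Adj A B := by
  by_cases hab : Hom.app A.fst k a = Hom.app A.fst k b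
  · exact eqvGen_of_fuses B hB A ⟨hB.1, hB.2.1, hab⟩
  have hfu : Fuses u k a b := B.comp_eq ▸ hB.comp B.snd
  have hlt := app_lt_of_siblings A.fst hB.lt hB.2.1 hab
  have hm : Monotone (Hom.app A.fst k) := by
    refine monotone_of_injective_above A.fst k fun j hj x y h => ?_
    rcases lt_trichotomy x y with hxy | hxy | hxy
    · exact absurd (eq_of_app_eq A.degree_fst hA.lt hA.2.2 hxy h).1 (by omega)
    · exact hxy
    · exact absurd (eq_of_app_eq A.degree_fst hA.lt hA.2.2 hxy h.symm).1 (by omega)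
  have hv : Fuses A.snd k (Hom.app A.fst k a) (Hom.app A.fst k b) := by
    refine ⟨?_, ?_, ?_⟩
    · by_contra hne
      have hlt' := Fin.lt_def.1 hlt
      obtain ⟨z, hz⟩ := A.fst.app_surj k ⟨Hom.app A.fst k a + 1, by omega⟩
      have hz' : (Hom.app A.fst k z : ℕ) = Hom.app A.fst k a + 1 := by rw [hz]
      have hB1 := hB.1
      rcases le_or_gt z a with h | h
      · have := Fin.le_def.1 (hm h)
        omega
      · rw [Fin.lt_def] at h
        have := Fin.le_def.1 (hm (Fin.le_def.2 (by omega) : b ≤ z))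
        omega
    · rw [← A.fst.comm, ← A.fst.comm, hB.2.1]
    · rw [A.app_eq, A.app_eq, hfu.2.2]
  obtain ⟨ρ, z, r, hr, hz, hzf⟩ := exists_factorization A.snd hv
  obtain ⟨θ', w, z', hwz, hw, hwf⟩ := exists_factorization (A.fst ≫ z)
    (⟨hB.1, hB.2.1, hzf.2.2⟩ : Fuses (A.fst ≫ z) k a b)
  have hz' : Hom.degree z' = 1 := by
    have := congrArg Hom.degree hwz
    rw [degree_comp, degree_comp, A.degree_fst, hw, hz] at this
    omega
  let C : Atom u := ⟨θ', w, z' ≫ r, by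
    rw [← Category.assoc, hwz, Category.assoc, hr, A.comp_eq], hw⟩
  exact (Relation.EqvGen.rel A C ⟨ρ, z, z', r, hwz.symm, hz, hz', hr, rfl⟩).trans _ _ _
    (eqvGen_of_fuses B hB C hwf)

/-- All factorizations of a morphism with a first step of degree one are connected by squares. -/
theorem eqvGen_adj (A B : Atom u) : Relation.EqvGen Adj A B := by
  obtain ⟨l, c, d, hA⟩ := exists_fuses_of_degree_eq_one A.degree_fst
  obtain ⟨k, a, b, hB⟩ := exists_fuses_of_degree_eq_one B.degree_fst
  rcases le_total l k with h | h
  · exact eqvGen_of_le A B hA hB h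
  · exact (eqvGen_of_le B A hB hA h).symm

end Atom

end PrunedTree

/-! ### From factorizations to paths, and the presentation -/

namespace PrunedTree

variable {n : ℕ}

/-- The path consisting of a single morphism of degree one. -/
def step {X Y : DegreeOne n} (w : X.tree ⟶ Y.tree) (hw : Hom.degree w = 1) :
    (Paths.of (DegreeOne n)).obj X ⟶ (Paths.of (DegreeOne n)).obj Y :=
  (Paths.of (DegreeOne n)).map ⟨w, hw⟩

/-- The composite of a path, as a morphism of trees. -/
def eval {X Y : DegreeOne n}
    (p : (Paths.of (DegreeOne n)).obj X ⟶ (Paths.of (DegreeOne n)).obj Y) : X.tree ⟶ Y.tree :=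
  (composite n).map p

section

variable {X Y Z : DegreeOne n}

theorem eval_comp (p : (Paths.of (DegreeOne n)).obj X ⟶ (Paths.of (DegreeOne n)).obj Y)
    (q : (Paths.of (DegreeOne n)).obj Y ⟶ (Paths.of (DegreeOne n)).obj Z) :
    eval (p ≫ q) = eval p ≫ eval q := (composite n).map_comp p q

theorem eval_step (w : X.tree ⟶ Y.tree) (hw : Hom.degree w = 1) : eval (step w hw) = w :=
  composite_map_of _

theorem degree_id (τ : PrunedTree n) : Hom.degree (𝟙 τ) = 0 := sub_self _

/-- A path is empty or has a first step. -/
theorem path_cases (p : (Paths.of (DegreeOne n)).obj X ⟶ (Paths.of (DegreeOne n)).obj Y) :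
    (Hom.degree (eval p) = 0 ∧ Quiver.Path.length p = 0) ∨
      ∃ (θ : PrunedTree n) (w : X.tree ⟶ θ) (hw : Hom.degree w = 1)
        (q : (Paths.of (DegreeOne n)).obj ⟨θ⟩ ⟶ (Paths.of (DegreeOne n)).obj Y),
        p = step (Y := ⟨θ⟩) w hw ≫ q := by
  by_cases h : Quiver.Path.length p = 0
  · left
    obtain rfl := Quiver.Path.eq_of_length_zero p h
    obtain rfl := Quiver.Path.eq_nil_of_length_zero p h
    exact ⟨degree_id _, rfl⟩
  · right
    obtain ⟨⟨θ⟩, ⟨w, hw⟩, q, hq, -⟩ := (Quiver.Path.length_ne_zero_iff_eq_comp p).1 h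
    exact ⟨θ, w, hw, q, hq⟩

/-- The morphisms of degree one generate. -/
theorem exists_eval_eq (u : X.tree ⟶ Y.tree) :
    ∃ p : (Paths.of (DegreeOne n)).obj X ⟶ (Paths.of (DegreeOne n)).obj Y, eval p = u := by
  obtain ⟨τ⟩ := X
  obtain ⟨σ⟩ := Y
  have key : ∀ (m : ℕ) (τ : PrunedTree n) (u : τ ⟶ σ), Hom.degree u = m →
      ∃ p : (Paths.of (DegreeOne n)).obj ⟨τ⟩ ⟶ (Paths.of (DegreeOne n)).obj ⟨σ⟩,
        eval p = u := by
    intro m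
    induction m with
    | zero =>
      intro τ u hu
      exact degree_zero_induction (P := fun σ u =>
        ∃ p : (Paths.of (DegreeOne n)).obj ⟨τ⟩ ⟶ (Paths.of (DegreeOne n)).obj ⟨σ⟩,
          eval p = u) ⟨𝟙 _, (composite n).map_id _⟩ u hu
    | succ m ih =>
      intro τ u hu
      push_cast at hu
      obtain ⟨k, a, b, hf⟩ := exists_fuses (w := u) (by omega)
      obtain ⟨θ, w, v, rfl, hw, -⟩ := exists_factorization u hf
      rw [degree_comp] at hu
      obtain ⟨p, rfl⟩ := ih θ v (by omega)
      exact ⟨step (X := ⟨τ⟩) (Y := ⟨θ⟩) w hw ≫ p, by rw [eval_comp, eval_step]⟩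
  have h0 := degree_nonneg u
  exact key (Hom.degree u).toNat τ u (by omega)

/-- A path of degree two has two steps. -/
theorem exists_eq_step_comp_step
    (p : (Paths.of (DegreeOne n)).obj X ⟶ (Paths.of (DegreeOne n)).obj Y)
    (hp : Hom.degree (eval p) = 2) :
    ∃ (θ : PrunedTree n) (w : X.tree ⟶ θ) (v : θ ⟶ Y.tree) (hw : Hom.degree w = 1)
      (hv : Hom.degree v = 1), p = step (Y := ⟨θ⟩) w hw ≫ step v hv := by
  rcases path_cases p with h | ⟨θ, w, hw, q, rfl⟩
  · omega
  rw [eval_comp, eval_step, degree_comp] at hp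
  rcases path_cases q with h | ⟨ρ, v, hv, r, rfl⟩
  · omega
  rw [eval_comp, eval_step, degree_comp] at hp
  rcases path_cases r with h | ⟨ρ', v', hv', r', rfl⟩
  · obtain rfl := Quiver.Path.eq_of_length_zero r h.2
    obtain rfl := Quiver.Path.eq_nil_of_length_zero r h.2
    exact ⟨θ, w, v, hw, hv, congrArg _ (Category.comp_id _)⟩
  · rw [eval_comp, eval_step, degree_comp] at hp
    have := degree_nonneg (eval r')
    omega

theorem orderLE_of_path_eq {θ θ' : PrunedTree n} {w : X.tree ⟶ θ} {w' : X.tree ⟶ θ'}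
    {v : θ ⟶ Y.tree} {v' : θ' ⟶ Y.tree} {hw : Hom.degree w = 1} {hw' : Hom.degree w' = 1}
    {hv : Hom.degree v = 1} {hv' : Hom.degree v' = 1}
    (h : step (Y := ⟨θ⟩) w hw ≫ step v hv = step (Y := ⟨θ'⟩) w' hw' ≫ step v' hv') :
    OrderLE w w' := by
  change Quiver.Path.cons (Quiver.Path.cons Quiver.Path.nil _) _ =
    Quiver.Path.cons (Quiver.Path.cons Quiver.Path.nil _) _ at h
  injection h with h1 _ h2
  injection h1 with h1
  subst h1
  injection eq_of_heq h2 with _ _ _ h3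
  injection h3 with h3
  subst h3
  exact fun i x y hxy => hxy

theorem path_eq_of_orderLE {θ θ' : PrunedTree n} {w : X.tree ⟶ θ} {w' : X.tree ⟶ θ'}
    {v : θ ⟶ Y.tree} {v' : θ' ⟶ Y.tree} {hw : Hom.degree w = 1} {hw' : Hom.degree w' = 1}
    {hv : Hom.degree v = 1} {hv' : Hom.degree v' = 1} (h : w ≫ v = w' ≫ v')
    (hle : OrderLE w w') :
    step (Y := ⟨θ⟩) w hw ≫ step v hv = step (Y := ⟨θ'⟩) w' hw' ≫ step v' hv' := by
  have e := Atom.eq_of_orderLE ⟨θ, w, v, h, hw⟩ ⟨θ', w', v', rfl, hw'⟩ hle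
  injection e with e₁ e₂ e₃
  subst e₁
  obtain rfl := eq_of_heq e₂
  obtain rfl := eq_of_heq e₃
  rfl

/-- The morphisms of degree two have exactly two factorizations, which form a quadratic
relation. -/
theorem exists_quadraticRelation (u : X.tree ⟶ Y.tree) (hu : Hom.degree u = 2) :
    ∃ p q : (Paths.of (DegreeOne n)).obj X ⟶ (Paths.of (DegreeOne n)).obj Y,
      p ≠ q ∧ QuadraticRelation n p q ∧ {r | eval r = u} = {p, q} := by
  obtain ⟨θ₁, θ₂, w₁, v₁, w₂, v₂, hw₁, hw₂, h₁, h₂, hq, hne, hall⟩ := exists_isQuadratic u hu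
  have hv₁ : Hom.degree v₁ = 1 := by rw [← h₁, degree_comp] at hu; omega
  have hv₂ : Hom.degree v₂ = 1 := by rw [← h₂, degree_comp] at hu; omega
  refine ⟨step (Y := ⟨θ₁⟩) w₁ hw₁ ≫ step v₁ hv₁, step (Y := ⟨θ₂⟩) w₂ hw₂ ≫ step v₂ hv₂,
    fun h => hne (orderLE_of_path_eq h),
    QuadraticRelation.intro (τ := X) (θ₁ := ⟨θ₁⟩) (θ₂ := ⟨θ₂⟩) (σ := Y) ⟨w₁, hw₁⟩ ⟨v₁, hv₁⟩
      ⟨w₂, hw₂⟩ ⟨v₂, hv₂⟩ (h₁.trans h₂.symm) hq, ?_⟩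
  ext r
  simp only [Set.mem_ofPred_eq, Set.mem_insert_iff, Set.mem_singleton_iff]
  constructor
  · rintro rfl
    obtain ⟨θ, w, v, hw, hv, rfl⟩ := exists_eq_step_comp_step r hu
    have he : eval (step (Y := ⟨θ⟩) w hw ≫ step v hv) = w ≫ v := by
      rw [eval_comp, eval_step, eval_step]
    rw [he] at h₁ h₂ hall
    rcases hall θ w v hw rfl with h | h
    · exact Or.inl (path_eq_of_orderLE h₁ h).symm
    · exact Or.inr (path_eq_of_orderLE h₂ h).symm
  · rintro (rfl | rfl)
    · rw [eval_comp, eval_step, eval_step, h₁]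
    · rw [eval_comp, eval_step, eval_step, h₂]

/-- The class of a path modulo the quadratic relations. -/
abbrev pathClass (p : (Paths.of (DegreeOne n)).obj X ⟶ (Paths.of (DegreeOne n)).obj Y) :=
  (Quotient.functor (QuadraticRelation n)).map p

theorem pathClass_eq_of_degree_two
    {p q : (Paths.of (DegreeOne n)).obj X ⟶ (Paths.of (DegreeOne n)).obj Y}
    (hp : Hom.degree (eval p) = 2) (h : eval p = eval q) : pathClass p = pathClass q := by
  obtain ⟨p', q', -, hr, hs⟩ := exists_quadraticRelation (eval p) hp
  have hpm : p ∈ ({r | eval r = eval p} : Set _) := rfl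
  have hqm : q ∈ ({r | eval r = eval p} : Set _) := h.symm
  have hpq : pathClass p' = pathClass q' := CategoryTheory.Quotient.sound _ hr
  rw [hs] at hpm hqm
  rcases hpm with rfl | rfl <;> rcases hqm with rfl | rfl
  · rfl
  · exact hpq
  · exact hpq.symm
  · rfl

/-- By induction on the degree, the remaining paths may be replaced by ones through the corner `ρ`
of the square with a common end; the square itself is the case of degree two. -/
theorem pathClass_eq_of_adj {u : X.tree ⟶ Y.tree} {A B : Atom u} (hAB : Atom.Adj A B)
    (ih : ∀ (θ : PrunedTree n) (p q : (Paths.of (DegreeOne n)).obj ⟨θ⟩ ⟶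
      (Paths.of (DegreeOne n)).obj Y), Hom.degree (eval p) + 1 = Hom.degree u → eval p = eval q →
        pathClass p = pathClass q)
    (p : (Paths.of (DegreeOne n)).obj ⟨A.tree⟩ ⟶ (Paths.of (DegreeOne n)).obj Y)
    (q : (Paths.of (DegreeOne n)).obj ⟨B.tree⟩ ⟶ (Paths.of (DegreeOne n)).obj Y)
    (hp : eval p = A.snd) (hq : eval q = B.snd) :
    pathClass (step (Y := ⟨A.tree⟩) A.fst A.degree_fst ≫ p) =
      pathClass (step (Y := ⟨B.tree⟩) B.fst B.degree_fst ≫ q) := by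
  obtain ⟨ρ, z, z', r, hz, hdz, hdz', hr, hr'⟩ := hAB
  obtain ⟨s, rfl⟩ := exists_eval_eq (X := ⟨ρ⟩) (Y := Y) r
  have hA := congrArg Hom.degree A.comp_eq
  have hB := congrArg Hom.degree B.comp_eq
  rw [degree_comp, A.degree_fst] at hA
  rw [degree_comp, B.degree_fst] at hB
  have h1 : pathClass p = pathClass (step (X := ⟨A.tree⟩) (Y := ⟨ρ⟩) z hdz ≫ s) :=
    ih _ _ _ (by rw [hp]; omega) (by rw [hp, eval_comp, eval_step, hr])
  have h2 : pathClass q = pathClass (step (X := ⟨B.tree⟩) (Y := ⟨ρ⟩) z' hdz' ≫ s) :=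
    ih _ _ _ (by rw [hq]; omega) (by rw [hq, eval_comp, eval_step, hr'])
  have h3 : pathClass (step (Y := ⟨A.tree⟩) A.fst A.degree_fst ≫
      step (X := ⟨A.tree⟩) (Y := ⟨ρ⟩) z hdz) =
      pathClass (step (Y := ⟨B.tree⟩) B.fst B.degree_fst ≫
        step (X := ⟨B.tree⟩) (Y := ⟨ρ⟩) z' hdz') := by
    refine pathClass_eq_of_degree_two ?_ ?_
    · rw [eval_comp, eval_step, eval_step, degree_comp, A.degree_fst, hdz]
      rfl
    · rw [eval_comp, eval_step, eval_step, eval_comp, eval_step, eval_step, hz]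
  simp only [pathClass, Functor.map_comp] at h1 h2 h3 ⊢
  rw [h1, h2, ← Category.assoc, ← Category.assoc, h3]

/-- Paths with the same composite are identified by the quadratic relations. -/
theorem pathClass_eq {p q : (Paths.of (DegreeOne n)).obj X ⟶ (Paths.of (DegreeOne n)).obj Y}
    (h : eval p = eval q) : pathClass p = pathClass q := by
  have key : ∀ (m : ℕ) (X : DegreeOne n)
      (p q : (Paths.of (DegreeOne n)).obj X ⟶ (Paths.of (DegreeOne n)).obj Y),
      Hom.degree (eval p) = m → eval p = eval q → pathClass p = pathClass q := by
    intro m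
    induction m with
    | zero =>
      intro X p q hm h
      have hlen : ∀ r : (Paths.of (DegreeOne n)).obj X ⟶ (Paths.of (DegreeOne n)).obj Y,
          Hom.degree (eval r) = 0 → Quiver.Path.length r = 0 := by
        intro r hr
        rcases path_cases r with h | ⟨θ, w, hw, r', rfl⟩
        · exact h.2
        · rw [eval_comp, eval_step, degree_comp] at hr
          have := degree_nonneg (eval r')
          omega
      have hp := hlen p hm
      have hq := hlen q (h ▸ hm)
      obtain rfl := Quiver.Path.eq_of_length_zero p hp
      obtain rfl := Quiver.Path.eq_nil_of_length_zero p hp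
      obtain rfl := Quiver.Path.eq_nil_of_length_zero q hq
      rfl
    | succ m ih =>
      intro X p q hm h
      push_cast at hm
      have hm' : Hom.degree (eval q) = m + 1 := h ▸ hm
      rcases path_cases p with hp | ⟨θ, w, hw, p, rfl⟩
      · omega
      rcases path_cases q with hq | ⟨θ', w', hw', q, rfl⟩
      · omega
      have ep : eval (step (Y := ⟨θ⟩) w hw ≫ p) = w ≫ eval p := by rw [eval_comp, eval_step]
      have eq : eval (step (Y := ⟨θ'⟩) w' hw' ≫ q) = w' ≫ eval q := by
        rw [eval_comp, eval_step]
      rw [ep, eq] at h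
      rw [ep] at hm
      have hdeg : ∀ A : Atom (w ≫ eval p), Hom.degree A.snd = m := fun A => by
        have := congrArg Hom.degree A.comp_eq
        rw [hm, degree_comp, A.degree_fst] at this
        omega
      let A : Atom (w ≫ eval p) := ⟨θ, w, eval p, rfl, hw⟩
      let B : Atom (w ≫ eval p) := ⟨θ', w', eval q, h.symm, hw'⟩
      -- The claim covers all paths representing the second factors, so that at an intermediate
      -- factorization any path may be chosen.
      have hconn : ∀ A B : Atom (w ≫ eval p), Relation.EqvGen Atom.Adj A B →
          ∀ (p : (Paths.of (DegreeOne n)).obj ⟨A.tree⟩ ⟶ (Paths.of (DegreeOne n)).obj Y)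
            (q : (Paths.of (DegreeOne n)).obj ⟨B.tree⟩ ⟶ (Paths.of (DegreeOne n)).obj Y),
            eval p = A.snd → eval q = B.snd →
            pathClass (step (Y := ⟨A.tree⟩) A.fst A.degree_fst ≫ p) =
              pathClass (step (Y := ⟨B.tree⟩) B.fst B.degree_fst ≫ q) := by
        intro A B hAB
        induction hAB with
        | rel A B hAB =>
          exact fun p q hp hq => pathClass_eq_of_adj hAB
            (fun θ p q hp => ih ⟨θ⟩ p q (by omega)) p q hp hq
        | refl A =>
          intro p q hp hq
          have := ih ⟨A.tree⟩ p q (by rw [hp, hdeg A]) (hp.trans hq.symm)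
          simp only [pathClass, Functor.map_comp] at this ⊢
          rw [this]
        | symm A B _ hAB => exact fun p q hp hq => (hAB q p hq hp).symm
        | trans A B C _ _ hAB hBC =>
          intro p q hp hq
          obtain ⟨r, hr⟩ := exists_eval_eq (X := ⟨B.tree⟩) (Y := Y) B.snd
          exact (hAB p r hp hr).trans (hBC r q hr hq)
      exact hconn A B (Atom.eqvGen_adj A B) p q rfl rfl
  have h0 := degree_nonneg (eval p)
  exact key (Hom.degree (eval p)).toNat X p q (by omega) h

end

theorem composite_map_surjective {X Y : Paths (DegreeOne n)} :
    Function.Surjective (fun p : X ⟶ Y => (composite n).map p) :=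
  fun u => exists_eval_eq (X := X) (Y := Y) u

theorem functor_map_eq_of_composite_eq {X Y : Paths (DegreeOne n)} {p q : X ⟶ Y}
    (h : (composite n).map p = (composite n).map q) :
    (Quotient.functor (QuadraticRelation n)).map p =
      (Quotient.functor (QuadraticRelation n)).map q :=
  pathClass_eq (X := X) (Y := Y) h

theorem presentation_obj_bijective : Function.Bijective (presentation n).obj := by
  refine ⟨?_, fun τ => ⟨⟨(⟨τ⟩ : DegreeOne n)⟩, rfl⟩⟩
  rintro ⟨⟨τ⟩⟩ ⟨⟨σ⟩⟩ h
  obtain rfl : τ = σ := h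
  rfl

theorem presentation_full : (presentation n).Full where
  map_surjective {X Y} u := by
    obtain ⟨p, hp⟩ := composite_map_surjective (X := X.as) (Y := Y.as) u
    exact ⟨(Quotient.functor (QuadraticRelation n)).map p, hp⟩

theorem presentation_faithful : (presentation n).Faithful where
  map_injective {X Y} f g h := by
    obtain ⟨p, rfl⟩ := (Quotient.functor (QuadraticRelation n)).map_surjective
      (X := X.as) (Y := Y.as) f
    obtain ⟨q, rfl⟩ := (Quotient.functor (QuadraticRelation n)).map_surjective
      (X := X.as) (Y := Y.as) g
    exact functor_map_eq_of_composite_eq h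

/-! ### The linear version -/

section Linear

universe u

variable {k : Type u} [CommRing k]

theorem linearComposite_obj_bijective : Function.Bijective (linearComposite k n).obj := by
  refine ⟨?_, fun τ => ⟨(⟨τ⟩ : DegreeOne n), rfl⟩⟩
  rintro ⟨τ⟩ ⟨σ⟩ h
  obtain rfl : τ = σ := h
  rfl

/-- The kernel of the linear map induced by a map of bases. -/
theorem mem_of_mapDomain_eq_zero {α β : Type*} {F : α → β} {S : Submodule k (α →₀ k)}
    (hS : ∀ p q, F p = F q → Finsupp.single p 1 - Finsupp.single q 1 ∈ S) {f : α →₀ k}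
    (hf : Finsupp.mapDomain F f = 0) : f ∈ S := by
  rcases isEmpty_or_nonempty α with hα | hα
  · rw [Subsingleton.elim f 0]
    exact S.zero_mem
  -- Each basis element is replaced by a chosen representative of its fibre. This changes `f` by an
  -- element of `S`, and the result depends only on the image of `f`, which is zero.
  have key : ∀ f : α →₀ k, f - Finsupp.mapDomain (Function.invFun F ∘ F) f ∈ S := by
    intro f
    induction f using Finsupp.induction_linear with
    | zero => simp
    | add f g hf hg =>
      rw [Finsupp.mapDomain_add, add_sub_add_comm]
      exact S.add_mem hf hg
    | single p r =>
      have := S.smul_mem r (hS p _ (Function.invFun_eq (f := F) ⟨p, rfl⟩).symm)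
      rwa [smul_sub, Finsupp.smul_single, Finsupp.smul_single, smul_eq_mul, mul_one,
        ← Function.comp_apply (f := Function.invFun F), ← Finsupp.mapDomain_single] at this
  have := key f
  rwa [Finsupp.mapDomain_comp, hf, Finsupp.mapDomain_zero, sub_zero] at this

variable {X Y : Free k (Paths (DegreeOne n))}

theorem linearComposite_map_surjective :
    Function.Surjective (fun f : X ⟶ Y => (linearComposite k n).map f) :=
  Finsupp.mapDomain_surjective (composite_map_surjective (n := n) (X := X) (Y := Y))

/-- The set-theoretic presentation provides a chain of elementary replacements inside longer paths;
each contributes a generator of the ideal up to sign, and the differences telescope. -/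
theorem embedding_sub_mem_quadraticIdeal {X Y : Paths (DegreeOne n)} {p q : X ⟶ Y}
    (h : (composite n).map p = (composite n).map q) :
    (Free.embedding k _).map p - (Free.embedding k _).map q ∈
      quadraticIdeal k n ((Free.embedding k _).obj X) ((Free.embedding k _).obj Y) := by
  have hg := (Quotient.functor_homRel_eq_compClosure_eqvGen _ p q).1
    (functor_map_eq_of_composite_eq h)
  clear h
  induction hg with
  | rel p q h =>
    obtain ⟨A, B, f, p, q, g, h⟩ := h
    refine Submodule.subset_span ⟨A, B, p, q, (Free.embedding k _).map f,
      (Free.embedding k _).map g, h, ?_⟩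
    rw [Functor.map_comp, Functor.map_comp, Functor.map_comp, Functor.map_comp,
      Preadditive.sub_comp, Preadditive.comp_sub]
  | refl p =>
    rw [sub_self]
    exact Submodule.zero_mem _
  | symm p q _ h =>
    rw [← neg_sub]
    exact Submodule.neg_mem _ h
  | trans p q r _ _ h h' =>
    rw [← sub_add_sub_cancel _ ((Free.embedding k _).map q)]
    exact Submodule.add_mem _ h h'

theorem linearComposite_map_eq_zero_of_mem {f : X ⟶ Y} (hf : f ∈ quadraticIdeal k n X Y) :
    (linearComposite k n).map f = 0 := by
  have hle : quadraticIdeal k n X Y ≤ LinearMap.ker (Finsupp.lmapDomain k k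
      (fun p : @Quiver.Hom (Paths (DegreeOne n)) _ X Y => (composite n).map p)) := by
    refine Submodule.span_le.2 ?_
    rintro _ ⟨A, B, p, q, f, g, h, rfl⟩
    change (linearComposite k n).map _ = 0
    have hz : (linearComposite k n).map
        ((Free.embedding k _).map p - (Free.embedding k _).map q) = 0 := by
      have hd : Finsupp.mapDomain (fun p : A ⟶ B => (composite n).map p)
          (Finsupp.single p (1 : k) - Finsupp.single q 1) = 0 := by
        rw [Finsupp.mapDomain_sub, Finsupp.mapDomain_single, Finsupp.mapDomain_single,
          h.composite_eq, sub_self]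
      exact hd
    rw [Functor.map_comp, Functor.map_comp, hz, Limits.zero_comp, Limits.comp_zero]
  exact hle hf

theorem linearComposite_map_eq_zero_iff {f : X ⟶ Y} :
    (linearComposite k n).map f = 0 ↔ f ∈ quadraticIdeal k n X Y :=
  ⟨fun h => mem_of_mapDomain_eq_zero (S := quadraticIdeal k n X Y)
    (F := fun p : @Quiver.Hom (Paths (DegreeOne n)) _ X Y => (composite n).map p)
    (fun _ _ hpq => embedding_sub_mem_quadraticIdeal hpq) h, linearComposite_map_eq_zero_of_mem⟩

end Linear

end PrunedTree

theorem mainTheorem6 (n : ℕ) :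
    -- the morphisms of degree two have exactly two factorizations, of one of the three types
    (∀ (X Y : Paths (PrunedTree.DegreeOne n))
        (u : (PrunedTree.composite n).obj X ⟶ (PrunedTree.composite n).obj Y),
        PrunedTree.Hom.degree u = 2 →
          ∃ p q : X ⟶ Y, p ≠ q ∧ PrunedTree.QuadraticRelation n p q ∧
            {r : X ⟶ Y | (PrunedTree.composite n).map r = u} = {p, q}) ∧
    -- the ordinary category presented by generators and quadratic relations is isomorphic
    -- to the category of pruned trees
    (Function.Bijective (PrunedTree.presentation n).obj ∧
      (PrunedTree.presentation n).Full ∧ (PrunedTree.presentation n).Faithful) ∧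
    -- the same for the categories enriched in modules over any commutative ring
    (∀ (k : Type*) [CommRing k],
      Function.Bijective (PrunedTree.linearComposite k n).obj ∧
      ∀ X Y : Free k (Paths (PrunedTree.DegreeOne n)),
        Function.Surjective
          (fun f : X ⟶ Y => (PrunedTree.linearComposite k n).map f) ∧
        ∀ f : X ⟶ Y, (PrunedTree.linearComposite k n).map f = 0 ↔
          f ∈ PrunedTree.quadraticIdeal k n X Y) := by
  refine ⟨fun X Y u hu => PrunedTree.exists_quadraticRelation (X := X) (Y := Y) u hu,
    ⟨PrunedTree.presentation_obj_bijective, PrunedTree.presentation_full,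
      PrunedTree.presentation_faithful⟩, fun k _ =>
    ⟨PrunedTree.linearComposite_obj_bijective, fun X Y =>
      ⟨PrunedTree.linearComposite_map_surjective, fun f =>
        PrunedTree.linearComposite_map_eq_zero_iff⟩⟩⟩
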